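/- An arena is a finite directed graph in which every vertex has an outgoing edge, with its vertex set partitioned into Eve's and Adam's vertices. A play is an infinite path; the player controlling the current vertex chooses the next edge, by a strategy that may depend on the whole history. Given reachability sets (colors) $F_1,\ldots,F_k$, a play is winning for Eve if for every $i$ it visits some vertex of $F_i$; Eve wins from $v_0$ if she has a strategy such that, against every strategy of Adam, the resulting play from $v_0$ is winning. The game is one-player if Adam controls no vertex. Theorem (Generalized reachability one-player games where each color appears twice). (1) The following problem is solvable in polynomial time by a deterministic Turing machine: given a one-player generalized reachability game whose reachability sets $F_1,\ldots,F_k$ all have exactly two elements (with $k\ge 0$ part of the input, and the game given explicitly, by its adjacency matrix and the characteristic vectors of the sets), and a starting vertex $v_0$, decide whether Eve wins from $v_0$. (2) In a one-player arena let $F_i=\{x_i,y_i\}$ with $x_i\neq y_i$ for $1\le i\le k$, and let $v_0$ be a vertex. Write $u\preceq v$ if there is a (possibly empty) path from $u$ to $v$. Then Eve wins from $v_0$ if and only if the following 2-CNF formula over the $2k$ variables $X_1,Y_1,\ldots,X_k,Y_k$ (where $X_i$ stands for $x_i$ and $Y_i$ for $y_i$) is satisfiable: $$\bigwedge\{(\neg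 P\vee\neg Q)\mid p\not\preceq q\text{ and }q\not\preceq p\}\ \wedge\ \bigwedge\{(\neg P\vee\neg P)\mid v_0\not\preceq p\}\ \wedge\ \bigwedge_{i}(X_i\vee Y_i),$$ where $P,Q$ range over the variables, standing for the colored vertices $p,q$. -/

import Mathlib

/-! ## Arenas, strategies and plays -/

/-- An arena on the vertex set `V`: a graph whose vertices are partitioned into those controlled by
Eve and those controlled by Adam. Plays are infinite and strategies always prescribe a legal move,
so every vertex has an outgoing edge. (Finiteness of `V` is required where arenas are used.) -/
structure Arena (V : Type*) where
  /-- the vertices controlled by Eve -/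
  eve : Set V
  /-- the vertices controlled by Adam -/
  adam : Set V
  partition : IsCompl eve adam
  edge : V → V → Prop
  exists_edge : ∀ v, ∃ w, edge v w

namespace Arena

variable {V : Type*}

/-- A strategy for the player controlling the vertices in `P`: given the history `w` (the vertices
seen before the current one, oldest first) and the current position `v ∈ P`, it prescribes a legal
move. -/
structure Strategy (A : Arena V) (P : Set V) where
  move : List V → P → V
  legal : ∀ (w : List V) (v : P), A.edge v (move w v)

theorem mem_adam_of_not_mem_eve (A : Arena V) {v : V} (h : v ∉ A.eve) : v ∈ A.adam := by
  have h2 : A.eveᶜ = A.adam := A.partition.compl_eq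
  exact h2 ▸ h

open Classical in
/-- The next vertex after the history `w` and the current position `v`, chosen by the strategy of
the player who controls `v`. -/
noncomputable def next (A : Arena V) (σ : A.Strategy A.eve) (τ : A.Strategy A.adam)
    (w : List V) (v : V) : V :=
  if h : v ∈ A.eve then σ.move w ⟨v, h⟩ else τ.move w ⟨v, A.mem_adam_of_not_mem_eve h⟩

/-- History and current position after `i` moves, from `v₀`, under the strategies `σ` and `τ`. -/
noncomputable def position (A : Arena V) (v₀ : V) (σ : A.Strategy A.eve) (τ : A.Strategy A.adam) :
    ℕ → List V × V
  | 0 => ([], v₀)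
  | i + 1 =>
    let p := position A v₀ σ τ i
    (p.1 ++ [p.2], A.next σ τ p.1 p.2)

/-- The play `π(v₀, σ, τ)`. -/
noncomputable def play (A : Arena V) (v₀ : V) (σ : A.Strategy A.eve) (τ : A.Strategy A.adam) :
    ℕ → V :=
  fun i => (A.position v₀ σ τ i).2

/-- All plays of the arena: the infinite paths of its graph. -/
def plays (A : Arena V) : Set (ℕ → V) :=
  {π | ∀ i, A.edge (π i) (π (i + 1))}

/-- The generalized reachability objective `GenReach(F₁, …, F_k)`. -/
def genReach (A : Arena V) {k : ℕ} (F : Fin k → Set V) : Set (ℕ → V) :=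
  {π ∈ A.plays | ∀ i, ∃ p, π p ∈ F i}

/-- Eve wins from `v₀` for the objective `Φ`. -/
def EveWins (A : Arena V) (Φ : Set (ℕ → V)) (v₀ : V) : Prop :=
  ∃ σ : A.Strategy A.eve, ∀ τ : A.Strategy A.adam, A.play v₀ σ τ ∈ Φ

/-- One-player arenas: Adam controls no vertex. -/
def IsOnePlayer (A : Arena V) : Prop :=
  A.adam = ∅

/-- There is a (possibly empty) path from `u` to `v`. -/
def Reachable (A : Arena V) (u v : V) : Prop :=
  Relation.ReflTransGen A.edge u v

end Arena

/-! ## Formulas in conjunctive normal form with two literals per clause -/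

/-- A literal: `(x, true)` stands for `x` and `(x, false)` for `¬ x`. -/
abbrev PropLiteral (X : Type*) := X × Bool

/-- A 2-CNF formula, as the set of its clauses `ℓ₁ ∨ ℓ₂`. -/
abbrev TwoCNF (X : Type*) := Set (PropLiteral X × PropLiteral X)

/-- Some assignment makes a literal of each clause true. -/
def TwoCNF.Satisfiable {X : Type*} (φ : TwoCNF X) : Prop :=
  ∃ a : X → Bool, ∀ c ∈ φ, a c.1.1 = c.1.2 ∨ a c.2.1 = c.2.2

/-- For `F_i = {x_i, y_i}`, the vertex that a variable stands for: `(i, false)` is the variable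
`X_i` of the vertex `x_i`, and `(i, true)` is the variable `Y_i` of the vertex `y_i`. -/
def coloredVertex {V : Type*} {k : ℕ} (x y : Fin k → V) (p : Fin k × Bool) : V :=
  if p.2 then y p.1 else x p.1

/-- The 2-CNF formula of a one-player game with reachability sets `{x_i, y_i}` and initial vertex
`v₀`, with the following clauses:
* `¬ P ∨ ¬ Q`, if neither of the colored vertices of `P` and `Q` is reachable from the other;
* `¬ P ∨ ¬ P`, if the colored vertex of `P` is not reachable from `v₀`;
* `X_i ∨ Y_i`, for every color `i`. -/
def Arena.formula {V : Type*} (A : Arena V) {k : ℕ} (x y : Fin k → V) (v₀ : V) :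
    TwoCNF (Fin k × Bool) :=
  {c | ∃ p q, ¬ A.Reachable (coloredVertex x y p) (coloredVertex x y q) ∧
      ¬ A.Reachable (coloredVertex x y q) (coloredVertex x y p) ∧ c = ((p, false), (q, false))} ∪
  {c | ∃ p, ¬ A.Reachable v₀ (coloredVertex x y p) ∧ c = ((p, false), (p, false))} ∪
  {c | ∃ i, c = (((i, false), true), ((i, true), true))}

/-! ## The decision problem and polynomial time -/

/-- An input of the problem of solving generalized reachability games: a generalized reachability
game on the vertices `0, …, n - 1`, with a starting vertex. -/
structure GenReachInput where
  /-- the number of vertices -/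
  n : ℕ
  arena : Arena (Fin n)
  /-- the number of colors -/
  k : ℕ
  /-- the reachability sets -/
  target : Fin k → Set (Fin n)
  /-- the starting vertex -/
  start : Fin n

namespace GenReachInput

/-- The question to be decided: does Eve win from the starting vertex? -/
def EveWins (I : GenReachInput) : Prop :=
  I.arena.EveWins (I.arena.genReach I.target) I.start

open Classical in
/-- The characteristic bit vector of a set of vertices, closed by the separator `none`. -/
noncomputable def encodeSet {n : ℕ} (S : Set (Fin n)) : List (Option Bool) :=
  (List.ofFn fun v => some (decide (v ∈ S))) ++ [none]

/-- The encoding of inputs as words over the three letters `0`, `1` and a separator: the set of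
vertices controlled by Eve, the starting vertex, the rows of the adjacency matrix, another
separator, and the reachability sets. -/
noncomputable def encode (I : GenReachInput) : List (Option Bool) :=
  encodeSet I.arena.eve ++ encodeSet {I.start} ++
    (List.ofFn fun u => encodeSet {v | I.arena.edge u v}).flatten ++ [none] ++
    (List.ofFn fun i => encodeSet (I.target i)).flatten

theorem encodeSet_length {n : ℕ} (S : Set (Fin n)) : (encodeSet S).length = n + 1 := by
  simp [encodeSet]

theorem encodeSet_inj {n : ℕ} {S T : Set (Fin n)} {l l' : List (Option Bool)}
    (h : encodeSet S ++ l = encodeSet T ++ l') : S = T ∧ l = l' := by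
  obtain ⟨h1, h2⟩ := List.append_inj h (by simp [encodeSet_length])
  refine ⟨?_, h2⟩
  have h3 := List.ofFn_injective (List.append_cancel_right h1)
  ext v
  simpa using congrFun h3 v

theorem flatten_encodeSet_inj {n : ℕ} : ∀ {k : ℕ} {f g : Fin k → Set (Fin n)}
    {l l' : List (Option Bool)}, (List.ofFn fun i => encodeSet (f i)).flatten ++ l =
      (List.ofFn fun i => encodeSet (g i)).flatten ++ l' → f = g ∧ l = l'
  | 0, f, g, l, l', h => ⟨Subsingleton.elim _ _, by simpa using h⟩
  | k + 1, f, g, l, l', h => by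
    simp only [List.ofFn_succ, List.flatten_cons, List.append_assoc] at h
    obtain ⟨h1, h2⟩ := encodeSet_inj h
    obtain ⟨h3, h4⟩ := flatten_encodeSet_inj h2
    refine ⟨funext fun i => ?_, h4⟩
    cases i using Fin.cases with
    | zero => exact h1
    | succ i => exact congrFun h3 i

theorem length_flatten_encodeSet {n k : ℕ} (f : Fin k → Set (Fin n)) :
    (List.ofFn fun i => encodeSet (f i)).flatten.length = k * (n + 1) := by
  simp [List.length_flatten, List.map_ofFn, Function.comp_def, encodeSet_length]

theorem idxOf_encodeSet {n : ℕ} (S : Set (Fin n)) (l : List (Option Bool)) :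
    (encodeSet S ++ l).idxOf none = n := by
  unfold encodeSet
  rw [List.append_assoc, List.idxOf_append_of_notMem (by simp [List.mem_ofFn])]
  simp

/-- Different inputs have different encodings. -/
theorem encode_injective : Function.Injective encode := by
  rintro ⟨n, A, k, F, s⟩ ⟨n', A', k', F', s'⟩ h
  simp only [encode, List.append_assoc] at h
  have hn : n = n' := by
    simpa only [idxOf_encodeSet] using congrArg (List.idxOf none) h
  subst hn
  obtain ⟨h1, h⟩ := encodeSet_inj h
  obtain ⟨h2, h⟩ := encodeSet_inj h
  obtain ⟨h3, h⟩ := flatten_encodeSet_inj h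
  have h := List.append_cancel_left h
  have hk : k = k' := by
    have := congrArg List.length h
    rw [length_flatten_encodeSet, length_flatten_encodeSet] at this
    exact Nat.eq_of_mul_eq_mul_right (Nat.succ_pos n) this
  subst hk
  have h4 : F = F' := (flatten_encodeSet_inj (l := []) (l' := []) (congrArg (· ++ []) h)).1
  have h5 : A = A' := by
    obtain ⟨e, a, p, E, t⟩ := A
    obtain ⟨e', a', p', E', t'⟩ := A'
    have h6 : E = E' := by
      funext u v
      exact congrFun (congrFun h3 u) v
    have h7 : a = a' := by rw [← p.compl_eq, ← p'.compl_eq, show e = e' from h1]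
    simp only at h1
    subst h1 h6 h7
    rfl
  rw [h4, h5, Set.singleton_injective h2]

end GenReachInput

open Classical in
/-- The decision problem "given `a : α`, does `P a` hold?", whose inputs are presented to the
machine as the words `enc a`, is solvable in polynomial time by a (deterministic, multi-stack)
Turing machine. -/
def SolvableInPolyTime {α Γ : Type} (enc : α → List Γ) (P : α → Prop) : Prop :=
  Nonempty (Turing.TM2ComputableInPolyTime enc Computability.encodeBool fun a => decide (P a))

/-!
The vertices that a play from `v₀` visits are reachable from `v₀` and pairwise comparable for `⪯`.
Conversely, a finite set of such vertices is a chain for `⪯`, and Eve, who owns the whole arena, can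
go through it from the bottom to the top. Hence she wins iff one can choose a vertex in each color
such that no two of the chosen vertices are in conflict, i.e. incomparable, and none of them is
unreachable from `v₀`; the latter is encoded as a conflict of the vertex with itself.

For colors with two elements this is 2-SAT. Choosing `u` forces the other element of each color of
which one element is in conflict with `u`, and the choice of `u` is doomed if it forces, directly or
not, a vertex in conflict with `u`. A choice exists iff each color has an element that is not
doomed: choose one together with everything it forces, and go on with the colors not met so far.

The machine keeps a matrix of cells, whose bits represent relations between the vertices, in two
stacks that meet at the current cell, and indices in unary counters. Every relation above, the two
transitive closures included (by Warshall's algorithm), is the result of a fixed number of sweeps,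
that let some registers range over the indices and apply one rule, setting a bit of a cell if some
other bits have given values.
-/

/-! ### One-player games -/

/-- A set that meets every member of the family `F` and contains no two vertices in conflict. A
vertex may be in conflict with itself, and then it is excluded from the set. -/
def IsConflictFreeTransversal {V ι : Type*} (C : V → V → Prop) (F : ι → Set V) (S : Set V) : Prop :=
  (∀ u ∈ S, ∀ v ∈ S, ¬ C u v) ∧ ∀ i, (F i ∩ S).Nonempty

namespace Arena

variable {V : Type*} {A : Arena V}

theorem reachable_of_mem_plays {π : ℕ → V} (hπ : π ∈ A.plays) {i j : ℕ} (hij : i ≤ j) :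
    A.Reachable (π i) (π j) :=
  Nat.rel_of_forall_rel_succ_of_le (Relation.ReflTransGen A.edge)
    (fun n => Relation.ReflTransGen.single (hπ n)) hij

theorem exists_play (A : Arena V) (v : V) : ∃ π ∈ A.plays, π 0 = v := by
  choose f hf using A.exists_edge
  exact ⟨fun i => f^[i] v, fun i => by simpa only [Function.iterate_succ_apply'] using hf _, rfl⟩

theorem Reachable.exists_play {u v : V} (h : A.Reachable u v) {π : ℕ → V} (hπ : π ∈ A.plays)
    (h₀ : π 0 = v) : ∃ π' ∈ A.plays, π' 0 = u ∧ Set.range π ⊆ Set.range π' := by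
  induction h using Relation.ReflTransGen.head_induction_on with
  | refl => exact ⟨π, hπ, h₀, subset_rfl⟩
  | @head a _ hab _ ih =>
    obtain ⟨π', hπ', rfl, hsub⟩ := ih
    refine ⟨fun i => Nat.casesOn i a π', fun i => ?_, rfl, hsub.trans ?_⟩
    · cases i with
      | zero => exact hab
      | succ i => exact hπ' i
    · rintro _ ⟨i, rfl⟩
      exact ⟨i + 1, rfl⟩

theorem exists_mem_forall_reachable {S : Finset V} (hne : S.Nonempty)
    (hS : ∀ u ∈ S, ∀ w ∈ S, A.Reachable u w ∨ A.Reachable w u) :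
    ∃ m ∈ S, ∀ u ∈ S, A.Reachable m u := by
  have : Nonempty S := hne.to_subtype
  have : IsTrans V (flip A.Reachable) := ⟨fun _ _ _ hab hbc => Relation.ReflTransGen.trans hbc hab⟩
  have hdir : Directed (flip A.Reachable) (Subtype.val : S → V) := fun u w =>
    (hS u u.2 w w.2).elim (fun h => ⟨u, Relation.ReflTransGen.refl, h⟩)
      fun h => ⟨w, h, Relation.ReflTransGen.refl⟩
  obtain ⟨m, hm⟩ := hdir.finset_le Finset.univ
  exact ⟨m, m.2, fun u hu => hm ⟨u, hu⟩ (Finset.mem_univ _)⟩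

theorem exists_play_of_chain (S : Finset V) (v : V) (hv : ∀ u ∈ S, A.Reachable v u)
    (hS : ∀ u ∈ S, ∀ w ∈ S, A.Reachable u w ∨ A.Reachable w u) :
    ∃ π ∈ A.plays, π 0 = v ∧ ↑S ⊆ Set.range π := by
  classical
  induction S using Finset.strongInduction generalizing v with
  | H S ih =>
    rcases S.eq_empty_or_nonempty with rfl | hne
    · obtain ⟨π, hπ, h₀⟩ := A.exists_play v
      exact ⟨π, hπ, h₀, by simp⟩
    · obtain ⟨m, hmS, hm⟩ := exists_mem_forall_reachable hne hS
      obtain ⟨π, hπ, h₀, hsub⟩ := ih (S.erase m) (Finset.erase_ssubset hmS) m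
        (fun u hu => hm u (Finset.mem_of_mem_erase hu))
        fun u hu w hw => hS u (Finset.mem_of_mem_erase hu) w (Finset.mem_of_mem_erase hw)
      obtain ⟨π', hπ', h₀', hsub'⟩ := (hv m hmS).exists_play hπ h₀
      refine ⟨π', hπ', h₀', fun u hu => hsub' ?_⟩
      rcases eq_or_ne u m with rfl | hum
      · exact ⟨0, h₀⟩
      · exact hsub (Finset.mem_erase.2 ⟨hum, hu⟩)

/-- The strategy of following the play `π`: the length of the history tells the time. Off the play,
the move is arbitrary. -/
noncomputable def Strategy.follow {π : ℕ → V} (hπ : π ∈ A.plays) (P : Set V) : A.Strategy P :=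
  open Classical in
  { move := fun w v =>
      if (v : V) = π w.length then π (w.length + 1) else (A.exists_edge v).choose
    legal := fun w v => by
      split_ifs with h
      · exact h ▸ hπ w.length
      · exact (A.exists_edge v).choose_spec }

theorem Strategy.follow_move {π : ℕ → V} (hπ : π ∈ A.plays) {P : Set V} {w : List V} {v : P}
    (hv : v = π w.length) : (Strategy.follow hπ P).move w v = π (w.length + 1) :=
  if_pos hv

theorem IsOnePlayer.mem_eve (hA : A.IsOnePlayer) (v : V) : v ∈ A.eve := by
  by_contra h
  exact Set.notMem_empty v (hA ▸ A.mem_adam_of_not_mem_eve h)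

theorem length_position (v₀ : V) (σ : A.Strategy A.eve) (τ : A.Strategy A.adam) (i : ℕ) :
    (A.position v₀ σ τ i).1.length = i := by
  induction i with
  | zero => rfl
  | succ i ih => simp [position, ih]

theorem IsOnePlayer.play_follow (hA : A.IsOnePlayer) {π : ℕ → V} (hπ : π ∈ A.plays)
    (τ : A.Strategy A.adam) : A.play (π 0) (Strategy.follow hπ A.eve) τ = π := by
  funext i
  induction i with
  | zero => rfl
  | succ i ih =>
    have hlen := length_position (π 0) (Strategy.follow hπ A.eve) τ i
    simp only [play, position, next, hA.mem_eve, dite_true]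
    rw [Strategy.follow_move hπ (by rw [hlen]; exact ih), hlen]

theorem IsOnePlayer.eveWins_iff (hA : A.IsOnePlayer) {Φ : Set (ℕ → V)} (hΦ : Φ ⊆ A.plays)
    {v₀ : V} : A.EveWins Φ v₀ ↔ ∃ π ∈ Φ, π 0 = v₀ := by
  constructor
  · rintro ⟨σ, hσ⟩
    have hadam (v : A.adam) : False := Set.notMem_empty _ (hA.subset v.2)
    exact ⟨_, hσ ⟨fun _ v => (hadam v).elim, fun _ v => (hadam v).elim⟩, rfl⟩
  · rintro ⟨π, hπ, rfl⟩
    exact ⟨.follow (hΦ hπ) _, fun τ => (hA.play_follow (hΦ hπ) τ).symm ▸ hπ⟩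

/-- Two vertices conflict if no play from `v₀` visits both of them. -/
def Conflict (A : Arena V) (v₀ u v : V) : Prop :=
  (¬ A.Reachable u v ∧ ¬ A.Reachable v u) ∨ ¬ A.Reachable v₀ u ∨ ¬ A.Reachable v₀ v

theorem Conflict.symm {v₀ u v : V} (h : A.Conflict v₀ u v) : A.Conflict v₀ v u :=
  h.imp And.symm Or.symm

theorem not_conflict_iff {v₀ u v : V} : ¬ A.Conflict v₀ u v ↔
    (A.Reachable u v ∨ A.Reachable v u) ∧ A.Reachable v₀ u ∧ A.Reachable v₀ v := by
  simp only [Conflict]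
  tauto

theorem not_conflict_of_mem_plays {π : ℕ → V} (hπ : π ∈ A.plays) (i j : ℕ) :
    ¬ A.Conflict (π 0) (π i) (π j) :=
  not_conflict_iff.2 ⟨(le_total i j).imp (reachable_of_mem_plays hπ) (reachable_of_mem_plays hπ),
    reachable_of_mem_plays hπ i.zero_le, reachable_of_mem_plays hπ j.zero_le⟩

theorem IsOnePlayer.eveWins_genReach_iff (hA : A.IsOnePlayer) {k : ℕ} (F : Fin k → Set V)
    (v₀ : V) :
    A.EveWins (A.genReach F) v₀ ↔ ∃ S, IsConflictFreeTransversal (A.Conflict v₀) F S := by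
  classical
  rw [hA.eveWins_iff fun π h => h.1]
  constructor
  · rintro ⟨π, ⟨hπ, hF⟩, rfl⟩
    refine ⟨Set.range π, ?_, fun i => ?_⟩
    · rintro _ ⟨i, rfl⟩ _ ⟨j, rfl⟩
      exact not_conflict_of_mem_plays hπ i j
    · obtain ⟨p, hp⟩ := hF i
      exact ⟨π p, hp, p, rfl⟩
  · rintro ⟨S, hfree, hmeet⟩
    choose f hfF hfS using hmeet
    have hf (i j) := not_conflict_iff.1 (hfree _ (hfS i) _ (hfS j))
    obtain ⟨π, hπ, h₀, hsub⟩ := exists_play_of_chain (A := A) (Finset.univ.image f) v₀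
      (by simpa using fun i => (hf i i).2.1) (by simpa using fun i j => (hf i j).1)
    refine ⟨π, ⟨hπ, fun i => ?_⟩, h₀⟩
    obtain ⟨p, hp⟩ := hsub (Finset.mem_coe.2 (Finset.mem_image_of_mem f (Finset.mem_univ i)))
    exact ⟨p, hp ▸ hfF i⟩

section Formula

variable {k : ℕ} {x y : Fin k → V} {v₀ : V}

theorem isConflictFreeTransversal_of_assignment {a : Fin k × Bool → Bool}
    (ha : ∀ c ∈ A.formula x y v₀, a c.1.1 = c.1.2 ∨ a c.2.1 = c.2.2) :
    IsConflictFreeTransversal (A.Conflict v₀) (fun i => {x i, y i})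
      (coloredVertex x y '' {p | a p = true}) := by
  have hreach (p) (hp : a p = true) : A.Reachable v₀ (coloredVertex x y p) := by
    by_contra h
    simpa [hp] using ha _ (.inl (.inr ⟨p, h, rfl⟩))
  refine ⟨?_, fun i => ?_⟩
  · rintro _ ⟨p, hp : a p = true, rfl⟩ _ ⟨q, hq : a q = true, rfl⟩
    refine not_conflict_iff.2 ⟨?_, hreach p hp, hreach q hq⟩
    by_contra! h
    simpa [hp, hq] using ha _ (.inl (.inl ⟨p, q, h.1, h.2, rfl⟩))
  · rcases ha _ (.inr ⟨i, rfl⟩) with h | h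
    · exact ⟨x i, .inl rfl, _, h, rfl⟩
    · exact ⟨y i, .inr rfl, _, h, rfl⟩

theorem formula_satisfiable_iff : (A.formula x y v₀).Satisfiable ↔
    ∃ S, IsConflictFreeTransversal (A.Conflict v₀) (fun i => {x i, y i}) S := by
  classical
  constructor
  · rintro ⟨a, ha⟩
    exact ⟨_, isConflictFreeTransversal_of_assignment ha⟩
  · rintro ⟨S, hfree, hmeet⟩
    refine ⟨fun p => decide (coloredVertex x y p ∈ S), ?_⟩
    rintro c ((⟨p, q, hpq, hqp, rfl⟩ | ⟨p, hp, rfl⟩) | ⟨i, rfl⟩)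
    · simp only [decide_eq_false_iff_not]
      by_contra! h
      exact hfree _ h.1 _ h.2 (.inl ⟨hpq, hqp⟩)
    · simp only [decide_eq_false_iff_not, or_self]
      exact fun h => hfree _ h _ h (.inr (.inl hp))
    · obtain ⟨v, rfl | rfl, hv⟩ := hmeet i
      · exact .inl (decide_eq_true hv)
      · exact .inr (decide_eq_true hv)

end Formula

theorem IsOnePlayer.eveWins_iff_formula_satisfiable (hA : A.IsOnePlayer) {k : ℕ} (x y : Fin k → V)
    (v₀ : V) :
    A.EveWins (A.genReach fun i => {x i, y i}) v₀ ↔ (A.formula x y v₀).Satisfiable :=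
  (hA.eveWins_genReach_iff _ v₀).trans formula_satisfiable_iff.symm

end Arena

/-! ### Conflict-free transversals of pairs -/

section Transversal

variable {V ι : Type*} {C : V → V → Prop} {F : ι → Set V} {T : Set V}

theorem exists_ne_forall_eq_or_eq {s : Set V} (hs : s.ncard = 2) {v : V} (hv : v ∈ s) :
    ∃ w ∈ s, v ≠ w ∧ ∀ u ∈ s, u = v ∨ u = w := by
  obtain ⟨a, b, hab, rfl⟩ := Set.ncard_eq_two.1 hs
  rcases hv with rfl | rfl
  · exact ⟨b, by simp, hab, by simp⟩
  · exact ⟨a, by simp, hab.symm, by simp [or_comm]⟩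

/-- The implications of 2-SAT between vertices: if `t` is chosen, then so is `w`, because another
element of a member of `F` containing `w` conflicts with `t`. -/
def Forces (C : V → V → Prop) (F : ι → Set V) (t w : V) : Prop :=
  ∃ i, ∃ u ∈ F i, w ∈ F i ∧ u ≠ w ∧ C t u

/-- A vertex that cannot be chosen, because it forces, in several steps, some vertex in conflict
with it. -/
def IsDoomed (C : V → V → Prop) (F : ι → Set V) (v : V) : Prop :=
  ∃ t, Relation.ReflTransGen (Forces C F) v t ∧ C v t

theorem Forces.mem_of_reflTransGen (hT : ∀ t ∈ T, ∀ w, Forces C F t w → w ∈ T) {v t : V}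
    (hv : v ∈ T) (h : Relation.ReflTransGen (Forces C F) v t) : t ∈ T := by
  induction h with
  | refl => exact hv
  | tail _ h ih => exact hT _ ih _ h

theorem Forces.exists_conflict (hC : ∀ u v, C u v → C v u)
    (hT : ∀ t ∈ T, ∀ w, Forces C F t w → w ∈ T) {v t u : V}
    (h : Relation.ReflTransGen (Forces C F) v t) (hu : u ∈ T) (htu : C t u) : ∃ u' ∈ T, C v u' := by
  induction h generalizing u with
  | refl => exact ⟨u, hu, htu⟩
  | tail _ h ih =>
    obtain ⟨i, w, hw, ht, hwt, hbw⟩ := h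
    exact ih (hT u hu w ⟨i, _, ht, hw, hwt.symm, hC _ _ htu⟩) hbw

theorem IsConflictFreeTransversal.mem_of_forces (hF : ∀ i, (F i).ncard = 2)
    (hT : IsConflictFreeTransversal C F T) {t w : V} (ht : t ∈ T) (h : Forces C F t w) : w ∈ T := by
  obtain ⟨i, u, hu, hw, huw, htu⟩ := h
  obtain ⟨z, hz, hzT⟩ := hT.2 i
  obtain ⟨w', -, -, hpair⟩ := exists_ne_forall_eq_or_eq (hF i) hu
  have hzu : z ≠ u := by
    rintro rfl
    exact hT.1 t ht z hzT htu
  rwa [(hpair w hw).resolve_left huw.symm, ← (hpair z hz).resolve_left hzu]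

/-- As in the algorithm for 2-SAT, a choice closed under forcing that leaves `F i` undecided is
extended by everything that an element of `F i` that is not doomed forces. -/
theorem exists_forces_closed_extension (hC : ∀ u v, C u v → C v u)
    (hfree : ∀ u ∈ T, ∀ v ∈ T, ¬ C u v) (hT : ∀ t ∈ T, ∀ w, Forces C F t w → w ∈ T) {i : ι}
    (hi : (F i).ncard = 2) (hmeet : ¬ (F i ∩ T).Nonempty) {v : V} (hv : v ∈ F i)
    (hdoomed : ¬ IsDoomed C F v) :
    ∃ T', T ⊆ T' ∧ v ∈ T' ∧ (∀ u ∈ T', ∀ w ∈ T', ¬ C u w) ∧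
      ∀ t ∈ T', ∀ w, Forces C F t w → w ∈ T' := by
  have hclosed : ∀ t, Relation.ReflTransGen (Forces C F) v t → ∀ w, Forces C F t w →
      Relation.ReflTransGen (Forces C F) v w := fun t ht w htw => ht.tail htw
  have hcross : ∀ t, Relation.ReflTransGen (Forces C F) v t → ∀ u ∈ T, ¬ C t u := by
    intro t ht u hu htu
    obtain ⟨u', hu', hvu'⟩ := Forces.exists_conflict hC hT ht hu htu
    obtain ⟨w, hw, hvw, -⟩ := exists_ne_forall_eq_or_eq hi hv
    exact hmeet ⟨w, hw, hT u' hu' w ⟨i, v, hv, hw, hvw, hC _ _ hvu'⟩⟩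
  refine ⟨T ∪ {t | Relation.ReflTransGen (Forces C F) v t}, Set.subset_union_left,
    .inr .refl, ?_, ?_⟩
  · rintro a (ha | ha) b (hb | hb) hab
    · exact hfree a ha b hb hab
    · exact hcross b hb a ha (hC _ _ hab)
    · exact hcross a ha b hb hab
    · exact hdoomed (Forces.exists_conflict hC hclosed ha hb hab)
  · rintro t (ht | ht) w htw
    · exact .inl (hT t ht w htw)
    · exact .inr (hclosed t ht w htw)

theorem exists_conflictFree_of_not_isDoomed (hC : ∀ u v, C u v → C v u)
    (hF : ∀ i, (F i).ncard = 2) (h : ∀ i, ∃ v ∈ F i, ¬ IsDoomed C F v) (s : Finset ι) :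
    ∃ T : Set V, (∀ u ∈ T, ∀ v ∈ T, ¬ C u v) ∧ (∀ t ∈ T, ∀ w, Forces C F t w → w ∈ T) ∧
      ∀ i ∈ s, (F i ∩ T).Nonempty := by
  induction s using Finset.cons_induction with
  | empty => exact ⟨∅, by simp, by simp, by simp⟩
  | cons i s _ ih =>
    obtain ⟨T, hfree, hT, hmeet⟩ := ih
    by_cases hi : (F i ∩ T).Nonempty
    · exact ⟨T, hfree, hT, by simpa [hi] using hmeet⟩
    · obtain ⟨v, hv, hdoomed⟩ := h i
      obtain ⟨T', hTT', hvT', hfree', hT'⟩ :=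
        exists_forces_closed_extension hC hfree hT (hF i) hi hv hdoomed
      refine ⟨T', hfree', hT', fun j hj => ?_⟩
      rcases Finset.mem_cons.1 hj with rfl | hj
      · exact ⟨v, hv, hvT'⟩
      · exact (hmeet j hj).mono (Set.inter_subset_inter_right _ hTT')

theorem exists_isConflictFreeTransversal_iff [Finite ι] (hC : ∀ u v, C u v → C v u)
    (hF : ∀ i, (F i).ncard = 2) :
    (∃ S, IsConflictFreeTransversal C F S) ↔ ∀ i, ∃ v ∈ F i, ¬ IsDoomed C F v := by
  constructor
  · rintro ⟨S, hS⟩ i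
    obtain ⟨v, hv, hvS⟩ := hS.2 i
    refine ⟨v, hv, fun ⟨t, hvt, hconflict⟩ => hS.1 v hvS t ?_ hconflict⟩
    exact Forces.mem_of_reflTransGen (fun t ht w => hS.mem_of_forces hF ht) hvS hvt
  · intro h
    have := Fintype.ofFinite ι
    obtain ⟨T, hfree, -, hmeet⟩ := exists_conflictFree_of_not_isDoomed hC hF h Finset.univ
    exact ⟨T, hfree, fun i => hmeet i (Finset.mem_univ i)⟩

end Transversal

/-! ### Transitive closure -/

/-- The relation computed by the first `m` rounds of Warshall's algorithm: paths whose inner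
vertices are less than `m`. -/
def warshall (E : ℕ → ℕ → Prop) : ℕ → ℕ → ℕ → Prop
  | 0, i, j => E i j
  | m + 1, i, j => warshall E m i j ∨ (warshall E m i m ∧ warshall E m m j)

theorem warshall_trans {E : ℕ → ℕ → Prop} {m i k j : ℕ} (hk : k < m) (hik : warshall E m i k)
    (hkj : warshall E m k j) : warshall E m i j := by
  induction m generalizing i k j with
  | zero => omega
  | succ m ih =>
    rcases Nat.lt_succ_iff_lt_or_eq.1 hk with hk | rfl
    · rcases hik with hik | ⟨him, hmk⟩ <;> rcases hkj with hkj | ⟨hkm, hmj⟩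
      · exact .inl (ih hk hik hkj)
      · exact .inr ⟨ih hk hik hkm, hmj⟩
      · exact .inr ⟨him, ih hk hmk hkj⟩
      · exact .inr ⟨him, hmj⟩
    · exact .inr ⟨hik.elim id And.left, hkj.elim id And.right⟩

theorem warshall_of_edge {E : ℕ → ℕ → Prop} {i j : ℕ} (h : E i j) (m : ℕ) : warshall E m i j := by
  induction m with
  | zero => exact h
  | succ m ih => exact .inl ih

theorem warshall_of_reflTransGen {n : ℕ} {E : ℕ → ℕ → Prop} {R : Fin n → Fin n → Prop}
    (hrefl : ∀ u : Fin n, E u u) (hedge : ∀ u v : Fin n, R u v → E u v) {u v : Fin n}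
    (h : Relation.ReflTransGen R u v) : warshall E n u v := by
  induction h with
  | refl => exact warshall_of_edge (hrefl u) n
  | @tail b c _ hbc ih => exact warshall_trans b.2 ih (warshall_of_edge (hedge b c hbc) n)

/-! ### Structured programs for multi-stack machines -/

open Turing StateTransition

/-- A program for a multi-stack machine: a machine with an entry, left by halting. -/
structure Program {K : Type} (Γ : K → Type) (σ : Type) where
  Λ : Type
  [fintype : Fintype Λ]
  entry : Λ
  m : Λ → TM2.Stmt Γ Λ σ

namespace Program

variable {K : Type} {Γ : K → Type} {Λ Λ' σ : Type}

/-- What a program acts on: the control state and the contents of the stacks. -/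
abbrev State (Γ : K → Type) (σ : Type) :=
  σ × ∀ k, List (Γ k)

/-- The statement `q` with renamed labels, in which `r` replaces halting. -/
def graft (q : TM2.Stmt Γ Λ σ) (f : Λ → Λ') (r : TM2.Stmt Γ Λ' σ) : TM2.Stmt Γ Λ' σ :=
  match q with
  | .push k g q => .push k g (graft q f r)
  | .peek k g q => .peek k g (graft q f r)
  | .pop k g q => .pop k g (graft q f r)
  | .load g q => .load g (graft q f r)
  | .branch g q₁ q₂ => .branch g (graft q₁ f r) (graft q₂ f r)
  | .goto l => .goto (f ∘ l)
  | .halt => r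

variable [DecidableEq K]

theorem stepAux_graft (f : Λ → Λ') (r : TM2.Stmt Γ Λ' σ) (q : TM2.Stmt Γ Λ σ) (v : σ)
    (S : ∀ k, List (Γ k)) :
    TM2.stepAux (graft q f r) v S =
      match TM2.stepAux q v S with
      | ⟨some l, v', S'⟩ => ⟨some (f l), v', S'⟩
      | ⟨none, v', S'⟩ => TM2.stepAux r v' S' := by
  induction q generalizing v S with
  | branch g q₁ q₂ ih₁ ih₂ =>
    simp only [graft, TM2.stepAux]
    cases g v
    · exact ih₂ v S
    · exact ih₁ v S
  | goto l => rfl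
  | halt => rfl
  | _ => simp only [graft, TM2.stepAux, *]

theorem evals_graft {m : Λ → TM2.Stmt Γ Λ σ} {m' : Λ' → TM2.Stmt Γ Λ' σ} (f : Λ → Λ')
    {r : TM2.Stmt Γ Λ' σ} {next : Option Λ'} (hm : ∀ l, m' (f l) = graft (m l) f r)
    (hr : ∀ v S, TM2.stepAux r v S = ⟨next, v, S⟩) {t : ℕ} {l : Λ} {v v' : σ}
    {S S' : ∀ k, List (Γ k)}
    (h : (flip bind (TM2.step m))^[t] (some ⟨some l, v, S⟩) = some ⟨none, v', S'⟩) :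
    (flip bind (TM2.step m'))^[t] (some ⟨some (f l), v, S⟩) = some ⟨next, v', S'⟩ := by
  induction t generalizing l v S with
  | zero => simp at h
  | succ t ih =>
    change (flip bind (TM2.step m))^[t] (some (TM2.stepAux (m l) v S)) = _ at h
    change (flip bind (TM2.step m'))^[t] (some (TM2.stepAux (m' (f l)) v S)) = _
    rw [hm, stepAux_graft]
    generalize TM2.stepAux (m l) v S = c at h ⊢
    obtain ⟨_ | l₁, v₁, S₁⟩ := c
    · cases t with
      | zero =>
        cases h
        exact congrArg some (hr _ _)
      | succ t =>
        have hnone : (flip bind (TM2.step m))^[t] none = none := Function.iterate_fixed rfl t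
        exact absurd (hnone.symm.trans h) (by simp)
    · exact ih h

/-- The program `P` leads from `c` to `c'` in at most `t` steps. -/
def Runs (P : Program Γ σ) (t : ℕ) (c c' : State Γ σ) : Prop :=
  Nonempty (EvalsToInTime (TM2.step P.m) ⟨some P.entry, c.1, c.2⟩ (some ⟨none, c'.1, c'.2⟩) t)

theorem Runs.mono {P : Program Γ σ} {t t' : ℕ} {c c' : State Γ σ} (h : P.Runs t c c')
    (ht : t ≤ t') : P.Runs t' c c' :=
  h.map fun h => { h with steps_le_m := h.steps_le_m.trans ht }

theorem Runs.embed {P : Program Γ σ} {m : Λ → TM2.Stmt Γ Λ σ} (f : P.Λ → Λ)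
    {r : TM2.Stmt Γ Λ σ} {next : Option Λ} (hm : ∀ l, m (f l) = graft (P.m l) f r)
    (hr : ∀ v S, TM2.stepAux r v S = ⟨next, v, S⟩) {t : ℕ} {c c' : State Γ σ}
    (h : P.Runs t c c') :
    Nonempty
      (EvalsToInTime (TM2.step m) ⟨some (f P.entry), c.1, c.2⟩ (some ⟨next, c'.1, c'.2⟩) t) :=
  h.map fun h => ⟨⟨h.steps, evals_graft f hm hr h.evals_in_steps⟩, h.steps_le_m⟩

/-- The effect of a statement without jumps. -/
def exec (q : TM2.Stmt Γ Empty σ) (c : State Γ σ) : State Γ σ :=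
  ((TM2.stepAux q c.1 c.2).var, (TM2.stepAux q c.1 c.2).stk)

theorem stepAux_graft_elim (r : TM2.Stmt Γ Λ σ) (q : TM2.Stmt Γ Empty σ) (c : State Γ σ) :
    TM2.stepAux (graft q Empty.elim r) c.1 c.2 = TM2.stepAux r (exec q c).1 (exec q c).2 := by
  rw [stepAux_graft]
  unfold exec
  rcases TM2.stepAux q c.1 c.2 with ⟨l | l, v, S⟩
  · rfl
  · exact l.elim

/-- The program consisting of a single statement without jumps. -/
def basic (q : TM2.Stmt Γ Empty σ) : Program Γ σ where
  Λ := Unit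
  entry := ()
  m _ := graft q Empty.elim .halt

theorem runs_basic {q : TM2.Stmt Γ Empty σ} {c c' : State Γ σ} (h : exec q c = c') :
    (basic q).Runs 1 c c' :=
  h ▸ ⟨⟨1, congrArg some (stepAux_graft_elim .halt q c)⟩, le_rfl⟩

/-- First `P`, then `Q`. -/
def seq (P Q : Program Γ σ) : Program Γ σ where
  Λ := P.Λ ⊕ Q.Λ
  fintype := @instFintypeSum _ _ P.fintype Q.fintype
  entry := .inl P.entry
  m
    | .inl l => graft (P.m l) .inl (.goto fun _ => .inr Q.entry)
    | .inr l => graft (Q.m l) .inr .halt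

theorem Runs.seq {P Q : Program Γ σ} {t t' : ℕ} {c c' c'' : State Γ σ} (h : P.Runs t c c')
    (h' : Q.Runs t' c' c'') : (P.seq Q).Runs (t + t') c c'' := by
  obtain ⟨h⟩ := h.embed (m := (P.seq Q).m) Sum.inl (fun l => rfl) fun v S => rfl
  obtain ⟨h'⟩ := h'.embed (m := (P.seq Q).m) Sum.inr (fun l => rfl) fun v S => rfl
  exact add_comm t t' ▸ ⟨h.trans _ _ _ _ _ _ h'⟩

/-- Execute `q`; if `test` holds then, execute `P` and repeat. -/
def whileDo (q : TM2.Stmt Γ Empty σ) (test : σ → Bool) (P : Program Γ σ) : Program Γ σ where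
  Λ := Option P.Λ
  fintype := @instFintypeOption _ P.fintype
  entry := none
  m
    | none => graft q Empty.elim (.branch test (.goto fun _ => some P.entry) .halt)
    | some l => graft (P.m l) some (.goto fun _ => none)

variable {q : TM2.Stmt Γ Empty σ} {test : σ → Bool} {P : Program Γ σ}

theorem runs_whileDo_of_false {c : State Γ σ} (h : test (exec q c).1 = false) :
    (whileDo q test P).Runs 1 c (exec q c) :=
  ⟨⟨1, congrArg some ((stepAux_graft_elim _ q c).trans (by simp [TM2.stepAux, h]))⟩, le_rfl⟩

theorem runs_whileDo_of_true {c c' c'' : State Γ σ} {t t' : ℕ} (h : test (exec q c).1 = true)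
    (hP : P.Runs t (exec q c) c') (hloop : (whileDo q test P).Runs t' c' c'') :
    (whileDo q test P).Runs (t + 1 + t') c c'' := by
  have htest : EvalsToInTime (TM2.step (whileDo q test P).m) ⟨some none, c.1, c.2⟩
      (some ⟨some (some P.entry), (exec q c).1, (exec q c).2⟩) 1 :=
    ⟨⟨1, congrArg some ((stepAux_graft_elim _ q c).trans (by simp [TM2.stepAux, h]))⟩, le_rfl⟩
  obtain ⟨hbody⟩ := hP.embed (m := (whileDo q test P).m) some (fun l => rfl) fun v S => rfl
  obtain ⟨hloop⟩ := hloop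
  exact add_comm t' _ ▸ ⟨(htest.trans _ _ _ _ _ _ hbody).trans _ _ _ _ _ _ hloop⟩

theorem runs_whileDo_range (c : ℕ → State Γ σ) (n t : ℕ)
    (hstep : ∀ x < n, test (exec q (c x)).1 = true ∧ P.Runs t (exec q (c x)) (c (x + 1)))
    (hlast : test (exec q (c n)).1 = false) :
    (whileDo q test P).Runs (n * (t + 1) + 1) (c 0) (exec q (c n)) := by
  induction n generalizing c with
  | zero => simpa using runs_whileDo_of_false hlast
  | succ n ih =>
    have h₀ := hstep 0 n.succ_pos
    have hrest := ih (fun x => c (x + 1)) (fun x hx => hstep (x + 1) (by omega)) hlast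
    exact (runs_whileDo_of_true h₀.1 h₀.2 hrest).mono (by linarith)

theorem runs_whileDo_list {α β : Type} (c : List α → β → State Γ σ) (f : β → α → β) (t : ℕ)
    (hstep : ∀ a l b, test (exec q (c (a :: l) b)).1 = true ∧
      P.Runs t (exec q (c (a :: l) b)) (c l (f b a)))
    (hlast : ∀ b, test (exec q (c [] b)).1 = false) (l : List α) (b : β) :
    (whileDo q test P).Runs (l.length * (t + 1) + 1) (c l b) (exec q (c [] (l.foldl f b))) := by
  induction l generalizing b with
  | nil => simpa using runs_whileDo_of_false (hlast b)
  | cons a l ih =>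
    refine (runs_whileDo_of_true (hstep a l b).1 (hstep a l b).2 (ih _)).mono ?_
    rw [List.length_cons]
    linarith

end Program

/-! ### A machine with a memory and index registers -/

namespace GridMachine

/-- A cell of the memory, with a bit for every element of `β`. -/
abbrev Cell (β : Type) :=
  β → Bool

/-- The symbols on the stacks that hold the memory: the cells, and a separator that closes each
row. -/
abbrev Sym (β : Type) :=
  Option (Cell β)

/-- The index registers: `row` ranges over the rows of the memory, the others over its columns. -/
inductive Register
  | row | i | j | k
  deriving DecidableEq

instance : Fintype Register :=
  ⟨{.row, .i, .j, .k}, by rintro (_ | _ | _ | _) <;> simp⟩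

/-- The unary counters: for each register, its value and the number of values it has not yet run
through, and an auxiliary counter. -/
inductive Counter
  | tmp
  | up (r : Register)
  | down (r : Register)
  deriving DecidableEq, Fintype

/-- The stacks of the machine: input, output, the memory to the left and to the right of the head,
and the counters. -/
inductive Stack
  | inp | out | left | right
  | counter (c : Counter)
  deriving DecidableEq, Fintype

/-- The alphabets of the stacks. -/
@[reducible]
def Alphabet (β : Type) : Stack → Type
  | .inp => Option Bool
  | .out => Bool
  | .left => Sym β
  | .right => Sym β
  | .counter _ => Unit

/-- The finite control: a flag, and a buffer for a symbol, which is empty between instructions. -/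
abbrev Control (β : Type) :=
  Bool × Option (Sym β)

variable {β : Type}

/-- Whether the buffer holds a cell. -/
@[simp]
def holdsCell (v : Control β) : Bool :=
  (v.2.getD none).isSome

/-- The contents of the stacks other than the counters. -/
structure Tapes (β : Type) where
  inp : List (Option Bool)
  out : List Bool
  left : List (Sym β)
  right : List (Sym β)

/-- The contents of all stacks. -/
@[simp]
def contents (T : Tapes β) (cnt : Counter → ℕ) : ∀ k, List (Alphabet β k)
  | .inp => T.inp
  | .out => T.out
  | .left => T.left
  | .right => T.right
  | .counter c => List.replicate (cnt c) ()

/-- The state of the machine. -/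
abbrev conf (v : Control β) (T : Tapes β) (cnt : Counter → ℕ) :
    Program.State (Alphabet β) (Control β) :=
  (v, contents T cnt)

section

variable (T : Tapes β) (cnt : Counter → ℕ)

@[simp] theorem update_contents_inp (w : List (Option Bool)) :
    Function.update (contents T cnt) .inp w = contents { T with inp := w } cnt := by
  funext k
  cases k <;> simp

@[simp] theorem update_contents_out (o : List Bool) :
    Function.update (contents T cnt) .out o = contents { T with out := o } cnt := by
  funext k
  cases k <;> simp

@[simp] theorem update_contents_left (l : List (Sym β)) :
    Function.update (contents T cnt) .left l = contents { T with left := l } cnt := by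
  funext k
  cases k <;> simp

@[simp] theorem update_contents_right (r : List (Sym β)) :
    Function.update (contents T cnt) .right r = contents { T with right := r } cnt := by
  funext k
  cases k <;> simp

theorem update_contents_counter (c : Counter) (x : ℕ) :
    Function.update (contents T cnt) (.counter c) (List.replicate x ()) =
      contents T (Function.update cnt c x) := by
  funext k
  cases k with
  | counter c' =>
    obtain rfl | h := eq_or_ne c' c
    · exact (Function.update_self ..).trans (by simp)
    · simp [h]
  | _ => simp

end

/-- A statement without jumps. -/
abbrev Line (β : Type) :=
  TM2.Stmt (Alphabet β) Empty (Control β)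

/-- Empty the buffer. -/
def clearBuf : Line β :=
  .load (fun v => (v.1, none)) .halt

/-- Pop a symbol of the memory into the buffer. -/
def popRight : Line β :=
  .pop .right (fun v x => (v.1, x)) .halt

/-- Push the buffer to the left of the head, and empty it. -/
def pushLeft : Line β :=
  .push .left (fun v => v.2.getD none) clearBuf

/-- Pop a symbol to the left of the head into the buffer. -/
def popLeft : Line β :=
  .pop .left (fun v x => (v.1, x)) .halt

/-- Push the buffer under the head, and empty it. -/
def pushRight : Line β :=
  .push .right (fun v => v.2.getD none) clearBuf

/-- Apply `f` to the flag and the cell under the head. -/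
def modify (f : Cell β → Bool → Cell β × Bool) : Line β :=
  .pop .right (fun v x => ((f ((x.getD none).getD fun _ => false) v.1).2,
    some (some (f ((x.getD none).getD fun _ => false) v.1).1)))
    pushRight

/-- Decrement a counter; the buffer tells whether it was positive. -/
def decrement (c : Counter) : Line β :=
  .pop (.counter c) (fun v x => (v.1, x.map fun _ => none)) .halt

/-- Increment a counter. -/
def increment (c : Counter) : Line β :=
  .push (.counter c) (fun _ => ()) clearBuf

section

variable {a : Bool} {b : Option (Sym β)} {T : Tapes β} {w : List (Option Bool)} {o : List Bool}
  {l r : List (Sym β)} {cnt : Counter → ℕ}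

@[simp] theorem exec_clearBuf :
    Program.exec clearBuf (conf (a, b) T cnt) = conf (a, none) T cnt := by
  simp [Program.exec, clearBuf]

@[simp] theorem exec_popRight : Program.exec popRight (conf (a, b) ⟨w, o, l, r⟩ cnt) =
    conf (a, r.head?) ⟨w, o, l, r.tail⟩ cnt := by
  simp [Program.exec, popRight]

@[simp] theorem exec_pushLeft (x : Sym β) :
    Program.exec pushLeft (conf (a, some x) ⟨w, o, l, r⟩ cnt) =
      conf (a, none) ⟨w, o, x :: l, r⟩ cnt := by
  simp [Program.exec, pushLeft, clearBuf]

@[simp] theorem exec_popLeft : Program.exec popLeft (conf (a, b) ⟨w, o, l, r⟩ cnt) =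
    conf (a, l.head?) ⟨w, o, l.tail, r⟩ cnt := by
  simp [Program.exec, popLeft]

@[simp] theorem exec_pushRight (x : Sym β) :
    Program.exec pushRight (conf (a, some x) ⟨w, o, l, r⟩ cnt) =
      conf (a, none) ⟨w, o, l, x :: r⟩ cnt := by
  simp [Program.exec, pushRight, clearBuf]

@[simp] theorem exec_modify (f : Cell β → Bool → Cell β × Bool) (x : Cell β) :
    Program.exec (modify f) (conf (a, b) ⟨w, o, l, some x :: r⟩ cnt) =
      conf ((f x a).2, none) ⟨w, o, l, some (f x a).1 :: r⟩ cnt := by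
  simp [Program.exec, modify, pushRight, clearBuf]

theorem exec_decrement (c : Counter) : Program.exec (decrement c) (conf (a, b) T cnt) =
    conf (a, if cnt c = 0 then none else some none) T (Function.update cnt c (cnt c - 1)) := by
  simp only [conf, ← update_contents_counter]
  by_cases h : cnt c = 0 <;> simp [Program.exec, decrement, List.head?_replicate, h]

theorem exec_decrement_of_zero {c : Counter} (h : cnt c = 0) :
    Program.exec (decrement c) (conf (a, b) T cnt) = conf (a, none) T cnt := by
  rw [exec_decrement, if_pos h, h, Nat.zero_sub, ← h, Function.update_eq_self]

theorem exec_increment (c : Counter) : Program.exec (increment c) (conf (a, b) T cnt) =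
    conf (a, none) T (Function.update cnt c (cnt c + 1)) := by
  simp only [conf, ← update_contents_counter]
  simp [Program.exec, increment, clearBuf, List.replicate_succ]

end

/-- Execute `P` and increment `c'`, until the counter `c`, which is decremented, is exhausted. -/
def countdown (c c' : Counter) (P : Program (Alphabet β) (Control β)) :
    Program (Alphabet β) (Control β) :=
  .whileDo (decrement c) (fun v => v.2.isSome)
    (.seq (.basic clearBuf) (.seq P (.basic (increment c'))))

theorem runs_countdown {c c' : Counter} (hc : c ≠ c') {P : Program (Alphabet β) (Control β)}
    {a : Bool} {cnt : Counter → ℕ} (T : ℕ → Tapes β) {t : ℕ}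
    (hP : ∀ x < cnt c, ∀ cnt',
      cnt' = Function.update (Function.update cnt c (cnt c - x - 1)) c' (cnt c' + x) →
      P.Runs t (conf (a, none) (T x) cnt') (conf (a, none) (T (x + 1)) cnt')) :
    (countdown c c' P).Runs (cnt c * (t + 3) + 1) (conf (a, none) (T 0) cnt)
      (conf (a, none) (T (cnt c))
        (Function.update (Function.update cnt c 0) c' (cnt c' + cnt c))) := by
  let count (x : ℕ) : Counter → ℕ :=
    Function.update (Function.update cnt c (cnt c - x)) c' (cnt c' + x)
  have hcount (x : ℕ) : count x c = cnt c - x := by simp [count, hc]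
  have hrun := Program.runs_whileDo_range (q := decrement c) (test := fun v => v.2.isSome)
    (P := .seq (.basic clearBuf) (.seq P (.basic (increment c'))))
    (fun x => conf (a, none) (T x) (count x)) (cnt c) (t + 2) ?_ ?_
  · rw [exec_decrement_of_zero (by simp [hcount])] at hrun
    simpa [count, countdown] using hrun
  · intro x hx
    have hpos : count x c ≠ 0 := by rw [hcount]; omega
    have hdec : Function.update (count x) c (count x c - 1) =
        Function.update (Function.update cnt c (cnt c - x - 1)) c' (cnt c' + x) := by
      simp [count, Function.update_comm hc]
    refine ⟨by simp [exec_decrement, hpos], ?_⟩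
    have hbody := (Program.runs_basic (exec_clearBuf (b := some none))).seq
      ((hP x hx _ rfl).seq (Program.runs_basic (exec_increment c')))
    rw [exec_decrement, if_neg hpos, hdec]
    simpa [count, Nat.sub_sub, add_comm 1, add_assoc] using hbody
  · simp [exec_decrement_of_zero, hcount]

section

variable {a : Bool} {w : List (Option Bool)} {o : List Bool} {l : List (Sym β)}
  {cnt : Counter → ℕ}

/-- Execute `P` as many times as the counter `c` tells, counting on `c'`, and restore both. -/
def iterate (c c' : Counter) (P : Program (Alphabet β) (Control β)) :
    Program (Alphabet β) (Control β) :=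
  .seq (countdown c c' P) (countdown c' c (.basic clearBuf))

theorem runs_iterate {c c' : Counter} (hc : c ≠ c') (hzero : cnt c' = 0)
    {P : Program (Alphabet β) (Control β)} (T : ℕ → Tapes β) {t : ℕ}
    (hP : ∀ x < cnt c, ∀ cnt',
      cnt' = Function.update (Function.update cnt c (cnt c - x - 1)) c' x →
      P.Runs t (conf (a, none) (T x) cnt') (conf (a, none) (T (x + 1)) cnt')) :
    (iterate c c' P).Runs (cnt c * (t + 7) + 2) (conf (a, none) (T 0) cnt)
      (conf (a, none) (T (cnt c)) cnt) := by
  have hcount := runs_countdown hc (cnt := cnt) (P := P) (a := a) T (by simpa [hzero] using hP)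
  have hrestore := runs_countdown hc.symm (a := a)
    (cnt := Function.update (Function.update cnt c 0) c' (cnt c))
    (fun _ => T (cnt c)) fun _ _ _ _ => Program.runs_basic exec_clearBuf
  have hcnt : Function.update (Function.update (Function.update (Function.update cnt c 0)
      c' (cnt c)) c' 0) c (cnt c) = cnt := by
    rw [Function.update_idem, Function.update_comm hc, Function.update_idem, ← hzero]
    simp
  simp only [hzero, zero_add, Function.update_self, Function.update_of_ne hc, hcnt]
    at hcount hrestore
  exact (hcount.seq hrestore).mono (by linarith)

/-- Move the head past the next separator. -/
def skipRow : Program (Alphabet β) (Control β) :=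
  .seq (.whileDo popRight holdsCell (.basic pushLeft)) (.basic pushLeft)

theorem runs_skipRow (s : List (Cell β)) (r : List (Sym β)) :
    skipRow.Runs (s.length * 2 + 2) (conf (a, none) ⟨w, o, l, s.map some ++ none :: r⟩ cnt)
      (conf (a, none) ⟨w, o, none :: ((s.map some).reverse ++ l), r⟩ cnt) := by
  have hloop := Program.runs_whileDo_list (q := popRight) (test := holdsCell)
    (P := .basic pushLeft)
    (fun s l => conf (a, none) ⟨w, o, l, s.map some ++ none :: r⟩ cnt)
    (fun l x => some x :: l) 1
    (fun x s l => ⟨by simp, Program.runs_basic (by simp)⟩)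
    (fun l => by simp) s l
  simpa [skipRow] using hloop.seq (Program.runs_basic (q := pushLeft)
    (c' := conf (a, none) ⟨w, o, none :: ((s.map some).reverse ++ l), r⟩ cnt) (by simp))

/-- Move the head back to the start of the memory. -/
def rewind : Program (Alphabet β) (Control β) :=
  .whileDo popLeft (fun v => v.2.isSome) (.basic pushRight)

theorem runs_rewind (r : List (Sym β)) :
    rewind.Runs (l.length * 2 + 1) (conf (a, none) ⟨w, o, l, r⟩ cnt)
      (conf (a, none) ⟨w, o, [], l.reverse ++ r⟩ cnt) := by
  have hloop := Program.runs_whileDo_list (q := popLeft)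
    (test := fun v : Control β => v.2.isSome) (P := .basic pushRight)
    (fun l r => conf (a, none) ⟨w, o, l, r⟩ cnt) (fun r x => x :: r) 1
    (fun x l r => ⟨by simp, Program.runs_basic (by simp)⟩)
    (fun r => by simp) l r
  simpa [rewind] using hloop

/-- The contents of the memory: the cell `M i j` is in row `i` and column `j`. -/
abbrev Mem (β : Type) :=
  ℕ → ℕ → Cell β

/-- The cells of row `i` in the columns from `s` up to, but not including, `e`. -/
def cells (M : Mem β) (i s e : ℕ) : List (Cell β) :=
  (List.range' s (e - s)).map (M i)

/-- The concatenation of the words in `L`, each closed by the separator `none`. -/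
def joinRows {α : Type} (L : List (List α)) : List (Option α) :=
  L.flatMap fun s => s.map some ++ [none]

/-- The rows of the memory from `s` up to, but not including, `e`, with `n` cells each. -/
def rows (M : Mem β) (n s e : ℕ) : List (Sym β) :=
  joinRows ((List.range' s (e - s)).map fun i => cells M i 0 n)

/-- Replace a cell. -/
def setCell (M : Mem β) (i j : ℕ) (c : Cell β) : Mem β :=
  Function.update M i (Function.update (M i) j c)

theorem range'_sub_eq_cons {s e : ℕ} (h : s < e) :
    List.range' s (e - s) = s :: List.range' (s + 1) (e - (s + 1)) := by
  rw [← Nat.sub_sub, ← List.range'_succ, Nat.sub_add_cancel (Nat.sub_pos_of_lt h)]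

theorem range'_sub_append {s m e : ℕ} (hs : s ≤ m) (he : m ≤ e) :
    List.range' s (m - s) ++ List.range' m (e - m) = List.range' s (e - s) := by
  have h := List.range'_append_1 (s := s) (m := m - s) (n := e - m)
  rwa [Nat.add_sub_cancel' hs, show m - s + (e - m) = e - s by omega] at h

theorem range'_succ_sub_eq_concat {s e : ℕ} (h : s ≤ e) :
    List.range' s (e + 1 - s) = List.range' s (e - s) ++ [e] := by
  rw [← range'_sub_append h (e.le_add_right 1), Nat.add_sub_cancel_left, List.range'_one]

theorem joinRows_cons {α : Type} (s : List α) (L : List (List α)) :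
    joinRows (s :: L) = s.map some ++ none :: joinRows L := by
  simp [joinRows]

theorem joinRows_append {α : Type} (L L' : List (List α)) :
    joinRows (L ++ L') = joinRows L ++ joinRows L' := by
  simp [joinRows]

theorem length_joinRows {α : Type} {n : ℕ} {L : List (List α)} (hL : ∀ s ∈ L, s.length = n) :
    (joinRows L).length = L.length * (n + 1) := by
  induction L with
  | nil => simp [joinRows]
  | cons s L ih =>
    obtain ⟨hs, hrows⟩ := List.forall_mem_cons.1 hL
    rw [joinRows_cons, List.length_append, List.length_cons, ih hrows, List.length_map, hs,
      List.length_cons]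
    ring

section

variable {M M' : Mem β} {n i s m e : ℕ}

theorem cells_eq_cons (h : s < e) : cells M i s e = M i s :: cells M i (s + 1) e := by
  rw [cells, range'_sub_eq_cons h, List.map_cons, cells]

theorem cells_append (hs : s ≤ m) (he : m ≤ e) :
    cells M i s m ++ cells M i m e = cells M i s e := by
  rw [cells, cells, cells, ← List.map_append, range'_sub_append hs he]

theorem cells_succ (h : s ≤ e) : cells M i s (e + 1) = cells M i s e ++ [M i e] := by
  rw [cells, range'_succ_sub_eq_concat h, List.map_append, List.map_singleton, cells]

theorem cells_congr (h : ∀ j, s ≤ j → j < e → M i j = M' i j) :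
    cells M i s e = cells M' i s e := by
  refine List.map_congr_left fun j hj => ?_
  rw [List.mem_range'_1] at hj
  exact h j hj.1 (by omega)

@[simp] theorem length_cells : (cells M i s e).length = e - s := by
  simp [cells]

theorem rows_eq_append (h : s < e) :
    rows M n s e = (cells M s 0 n).map some ++ none :: rows M n (s + 1) e := by
  rw [rows, range'_sub_eq_cons h, List.map_cons, joinRows_cons, rows]

theorem rows_append (hs : s ≤ m) (he : m ≤ e) : rows M n s m ++ rows M n m e = rows M n s e := by
  rw [rows, rows, rows, ← joinRows_append, ← List.map_append, range'_sub_append hs he]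

theorem rows_succ (h : s ≤ e) :
    rows M n s (e + 1) = rows M n s e ++ ((cells M e 0 n).map some ++ [none]) := by
  simp [rows, joinRows, range'_succ_sub_eq_concat h]

theorem rows_congr (h : ∀ i, s ≤ i → i < e → ∀ j < n, M i j = M' i j) :
    rows M n s e = rows M' n s e := by
  refine congrArg joinRows (List.map_congr_left fun i hi => ?_)
  rw [List.mem_range'_1] at hi
  rw [cells_congr fun j _ hj => h i hi.1 (by omega) j hj]

@[simp] theorem length_rows : (rows M n s e).length = (e - s) * (n + 1) := by
  rw [rows, length_joinRows (n := n) (List.forall_mem_map.2 fun _ _ => length_cells),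
    List.length_map, List.length_range']

theorem rows_setCell {N j : ℕ} (hi : i < N) (hj : j < n) (c : Cell β) :
    rows (setCell M i j c) n 0 N = rows M n 0 i ++ ((cells M i 0 j).map some ++
      some c :: ((cells M i (j + 1) n).map some ++ none :: rows M n (i + 1) N)) := by
  have hrow (x : ℕ) (hx : x ≠ i) (y : ℕ) : setCell M i j c x y = M x y := by
    rw [setCell, Function.update_of_ne hx]
  have hcol (y : ℕ) (hy : y ≠ j) : setCell M i j c i y = M i y := by
    rw [setCell, Function.update_self, Function.update_of_ne hy]
  rw [← rows_append i.zero_le hi.le, rows_eq_append hi, ← cells_append j.zero_le hj.le,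
    cells_eq_cons hj, rows_congr fun x _ hx y _ => hrow x hx.ne y,
    rows_congr (s := i + 1) fun x hx _ y _ => hrow x (by omega) y,
    cells_congr fun y _ hy => hcol y hy.ne,
    cells_congr (s := j + 1) fun y hy _ => hcol y (by omega)]
  simp [setCell]

end

/-- Apply `f` to the flag and the cell whose row and column are the values of `r` and `s`. -/
def access (r s : Register) (f : Cell β → Bool → Cell β × Bool) :
    Program (Alphabet β) (Control β) :=
  .seq (iterate (.up r) .tmp skipRow)
    (.seq (iterate (.up s) .tmp (.seq (.basic popRight) (.basic pushLeft)))
      (.seq (.basic (modify f)) rewind))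

theorem runs_iterate_skipRow {M : Mem β} {n N : ℕ} {r : Register} (htmp : cnt .tmp = 0)
    (hr : cnt (.up r) < N) :
    (iterate (.up r) .tmp skipRow).Runs (cnt (.up r) * (n * 2 + 9) + 2)
      (conf (a, none) ⟨w, o, [], rows M n 0 N⟩ cnt)
      (conf (a, none) ⟨w, o, (rows M n 0 (cnt (.up r))).reverse, rows M n (cnt (.up r)) N⟩ cnt) :=
  runs_iterate (by simp) htmp (fun x => ⟨w, o, (rows M n 0 x).reverse, rows M n x N⟩)
      fun x hx cnt' _ => by
    rw [rows_eq_append (hx.trans hr), rows_succ x.zero_le, List.reverse_append]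
    simpa using runs_skipRow (cells M x 0 n) (rows M n (x + 1) N)

theorem runs_iterate_skipCell {M : Mem β} {n i : ℕ} {r : List (Sym β)} {s : Register}
    (htmp : cnt .tmp = 0) (hs : cnt (.up s) < n) :
    (iterate (.up s) .tmp (.seq (.basic popRight) (.basic pushLeft))).Runs (cnt (.up s) * 9 + 2)
      (conf (a, none) ⟨w, o, l, (cells M i 0 n).map some ++ r⟩ cnt)
      (conf (a, none) ⟨w, o, ((cells M i 0 (cnt (.up s))).map some).reverse ++ l,
        (cells M i (cnt (.up s)) n).map some ++ r⟩ cnt) :=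
  runs_iterate (by simp) htmp
    (fun x => ⟨w, o, ((cells M i 0 x).map some).reverse ++ l, (cells M i x n).map some ++ r⟩)
    fun x hx cnt' _ => by
      rw [cells_eq_cons (hx.trans hs), cells_succ x.zero_le]
      exact (Program.runs_basic exec_popRight).seq (Program.runs_basic (by simp))

theorem runs_access {M : Mem β} {n N : ℕ} {r s : Register} (f : Cell β → Bool → Cell β × Bool)
    (htmp : cnt .tmp = 0) (hr : cnt (.up r) < N) (hs : cnt (.up s) < n) :
    (access r s f).Runs (N * (4 * n + 11) + 11 * n + 6)
      (conf (a, none) ⟨w, o, [], rows M n 0 N⟩ cnt)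
      (conf ((f (M (cnt (.up r)) (cnt (.up s))) a).2, none) ⟨w, o, [], rows (setCell M
        (cnt (.up r)) (cnt (.up s)) (f (M (cnt (.up r)) (cnt (.up s))) a).1) n 0 N⟩ cnt) := by
  have hrow := runs_iterate_skipRow (a := a) (w := w) (o := o) (M := M) (n := n) htmp hr
  rw [rows_eq_append hr] at hrow
  have hcell := runs_iterate_skipCell (a := a) (w := w) (o := o) (M := M) htmp hs
    (l := (rows M n 0 (cnt (.up r))).reverse) (i := cnt (.up r))
    (r := none :: rows M n (cnt (.up r) + 1) N)
  rw [cells_eq_cons hs] at hcell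
  have hrewind := runs_rewind (a := (f (M (cnt (.up r)) (cnt (.up s))) a).2) (w := w) (o := o)
    (cnt := cnt)
    (l := ((cells M (cnt (.up r)) 0 (cnt (.up s))).map some).reverse ++
      (rows M n 0 (cnt (.up r))).reverse)
    (some (f (M (cnt (.up r)) (cnt (.up s))) a).1 ::
      ((cells M (cnt (.up r)) (cnt (.up s) + 1) n).map some ++
        none :: rows M n (cnt (.up r) + 1) N))
  rw [rows_setCell hr hs]
  have hrun := hrow.seq (hcell.seq ((Program.runs_basic (exec_modify f _)).seq
    (by simpa using hrewind)))
  refine hrun.mono ?_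
  nlinarith

/-- A transformation of the memory, given the number of values and the current value of each
register. -/
abbrev Transformation (β : Type) :=
  (Register → ℕ) → (Register → ℕ) → Mem β → Mem β

/-- The number of values of a register, in a memory with `N` rows and `n` columns. -/
def bound (n N : ℕ) : Register → ℕ
  | .row => N
  | _ => n

/-- The values of the registers. -/
def values (cnt : Counter → ℕ) (r : Register) : ℕ :=
  cnt (.up r)

/-- The state between two transformations of the memory `M`, with `N` rows and `n` columns. -/
abbrev rep (n N : ℕ) (cnt : Counter → ℕ) (M : Mem β) :
    Program.State (Alphabet β) (Control β) :=
  conf (true, none) ⟨[], [], [], rows M n 0 N⟩ cnt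

/-- A program computes the transformation `f` in polynomial time, provided that the registers in `s`
have not yet run through any value. -/
def Realizable (s : Finset Register) (f : Transformation β) : Prop :=
  ∃ (P : Program (Alphabet β) (Control β)) (p : Polynomial ℕ), ∀ (m n N : ℕ) (cnt : Counter → ℕ)
    (M : Mem β), n ≤ N → N ≤ m → cnt .tmp = 0 → (∀ r, values cnt r < bound n N r) →
      (∀ r ∈ s, values cnt r = 0 ∧ cnt (.down r) = bound n N r) →
        P.Runs (p.eval m) (rep n N cnt M) (rep n N cnt (f (bound n N) (values cnt) M))

namespace Realizable

variable {s t : Finset Register} {f g : Transformation β}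

theorem mono (hf : Realizable s f) (hst : s ⊆ t) : Realizable t f := by
  obtain ⟨P, p, hP⟩ := hf
  exact ⟨P, p, fun m n N cnt M hn hN htmp hlt hs =>
    hP m n N cnt M hn hN htmp hlt fun r hr => hs r (hst hr)⟩

protected theorem id : Realizable s (fun _ _ M => M : Transformation β) :=
  ⟨.basic clearBuf, 1, fun m n N cnt M _ _ _ _ _ => by
    simpa using Program.runs_basic exec_clearBuf⟩

theorem comp (hg : Realizable s g) (hf : Realizable s f) :
    Realizable s fun b e M => g b e (f b e M) := by
  obtain ⟨P, p, hP⟩ := hf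
  obtain ⟨Q, q, hQ⟩ := hg
  refine ⟨P.seq Q, p + q, fun m n N cnt M hn hN htmp hlt hs => ?_⟩
  rw [Polynomial.eval_add]
  exact (hP m n N cnt M hn hN htmp hlt hs).seq (hQ m n N cnt _ hn hN htmp hlt hs)

end Realizable

/-- Apply `f` for all values of the register `r`. -/
def forEach (r : Register) (f : Transformation β) : Transformation β :=
  fun b e M => (List.range (b r)).foldl (fun M x => f b (Function.update e r x) M) M

theorem bound_le {n N : ℕ} (h : n ≤ N) (r : Register) : bound n N r ≤ N := by
  cases r <;> simp [bound, h]

theorem values_update_up (r : Register) (x : ℕ) :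
    values (Function.update cnt (.up r) x) = Function.update (values cnt) r x := by
  funext r'
  by_cases h : r' = r <;> simp [values, h]

theorem values_update_down (r : Register) (x : ℕ) :
    values (Function.update cnt (.down r) x) = values cnt := by
  funext r'
  simp [values]

theorem Realizable.forEach {s : Finset Register} {f : Transformation β} (hf : Realizable s f)
    {r : Register} (hr : r ∉ s) : Realizable (insert r s) (forEach r f) := by
  obtain ⟨P, p, hP⟩ := hf
  refine ⟨iterate (.down r) (.up r) P, .X * (p + 7) + 2, fun m n N cnt M hn hN htmp hlt hs => ?_⟩
  obtain ⟨hup, hdown⟩ := hs r (Finset.mem_insert_self r s)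
  let memory (x : ℕ) : Mem β := (List.range x).foldl
    (fun M x => f (bound n N) (Function.update (values cnt) r x) M) M
  have hloop := runs_iterate (c := .down r) (c' := .up r) (by simp) hup (a := true)
    (P := P) (t := p.eval m) (fun x => ⟨[], [], [], rows (memory x) n 0 N⟩) ?_
  · rw [hdown] at hloop
    refine hloop.mono ?_
    have hm := (bound_le hn r).trans hN
    simp only [Polynomial.eval_add, Polynomial.eval_mul, Polynomial.eval_X, Polynomial.eval_ofNat]
    nlinarith
  · rintro x hx cnt' rfl
    have hmemory : memory (x + 1) =
        f (bound n N) (Function.update (values cnt) r x) (memory x) := by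
      simp [memory, List.range_succ]
    have hvalues : values (Function.update (Function.update cnt (.down r) (cnt (.down r) - x - 1))
        (.up r) x) = Function.update (values cnt) r x := by
      rw [values_update_up, values_update_down]
    rw [hmemory, ← hvalues]
    refine hP m n N _ _ hn hN (by simp [htmp]) (fun r' => ?_) fun r' hr' => ?_
    · rw [hvalues]
      obtain rfl | h := eq_or_ne r' r
      · simpa [hdown] using hx
      · simpa [h] using hlt r'
    · have h : r' ≠ r := by
        rintro rfl
        exact hr hr'
      simpa [hvalues, h] using hs r' (Finset.mem_insert_of_mem hr')

end

/-! ### Rules -/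

/-- The condition that a bit of the cell in the given row and column is `val`. -/
structure Atom (β : Type) where
  row : Register
  col : Register
  bit : β
  val : Bool

/-- If all atoms in `body` are true, then set the bit `bit` of the cell in the given row and
column. -/
structure Rule (β : Type) where
  body : List (Atom β)
  row : Register
  col : Register
  bit : β

namespace Rule

/-- The columns of the cells of a rule are values of registers that range over the columns. -/
abbrev Legal (R : Rule β) : Prop :=
  (∀ A ∈ R.body, A.col ≠ .row) ∧ R.col ≠ .row

/-- A rule without negated atoms. -/
def Positive (R : Rule β) : Prop :=
  ∀ A ∈ R.body, A.val = true

/-- All atoms of the rule are true. -/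
def Fires (R : Rule β) (e : Register → ℕ) (M : Mem β) : Prop :=
  ∀ A ∈ R.body, M (e A.row) (e A.col) A.bit = A.val

instance (R : Rule β) (e : Register → ℕ) (M : Mem β) : Decidable (R.Fires e M) :=
  inferInstanceAs (Decidable (∀ A ∈ R.body, M (e A.row) (e A.col) A.bit = A.val))

variable {R : Rule β} {e : Register → ℕ} {M M' : Mem β}

theorem Positive.fires_mono (hR : R.Positive) (hM : M ≤ M') (h : R.Fires e M) : R.Fires e M' :=
  fun A hA => (hR A hA).symm ▸ Bool.le_iff_imp.1 (hM _ _ _) ((h A hA).trans (hR A hA))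

variable [DecidableEq β]

/-- The memory after an application of the rule. -/
def apply (R : Rule β) (e : Register → ℕ) (M : Mem β) : Mem β :=
  if R.Fires e M then
    setCell M (e R.row) (e R.col) (Function.update (M (e R.row) (e R.col)) R.bit true)
  else M

theorem apply_apply {u v : ℕ} {t : β} : R.apply e M u v t = true ↔
    M u v t = true ∨ R.Fires e M ∧ u = e R.row ∧ v = e R.col ∧ t = R.bit := by
  by_cases h : R.Fires e M
  · by_cases hu : u = e R.row <;> by_cases hv : v = e R.col <;> by_cases ht : t = R.bit <;>
      simp [apply, setCell, h, hu, hv, ht]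
  · simp [apply, h]

theorem le_apply : M ≤ R.apply e M := fun _ _ _ =>
  Bool.le_iff_imp.2 fun h => apply_apply.2 (.inl h)

end Rule

/-! ### Programs that apply rules -/

theorem setCell_self (M : Mem β) (i j : ℕ) : setCell M i j (M i j) = M := by
  simp [setCell]

theorem exists_access_runs (r : Register) {s : Register} (hs : s ≠ .row)
    (f : Cell β → Bool → Cell β × Bool) :
    ∃ (P : Program (Alphabet β) (Control β)) (p : Polynomial ℕ), ∀ (m n N : ℕ) (a : Bool)
      (cnt : Counter → ℕ) (M : Mem β), n ≤ N → N ≤ m → cnt .tmp = 0 →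
      (∀ r, values cnt r < bound n N r) →
      P.Runs (p.eval m) (conf (a, none) ⟨[], [], [], rows M n 0 N⟩ cnt)
        (conf ((f (M (values cnt r) (values cnt s)) a).2, none) ⟨[], [], [], rows (setCell M
          (values cnt r) (values cnt s) (f (M (values cnt r) (values cnt s)) a).1) n 0 N⟩ cnt) := by
  refine ⟨access r s f, .X * (4 * .X + 11) + 11 * .X + 6, fun m n N a cnt M hn hN htmp hlt => ?_⟩
  have hs' : values cnt s < n := by
    cases s
    · exact absurd rfl hs
    all_goals exact hlt _
  refine (runs_access f htmp ((hlt r).trans_le (bound_le hn r)) hs').mono ?_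
  simp only [Polynomial.eval_add, Polynomial.eval_mul, Polynomial.eval_X, Polynomial.eval_ofNat]
  nlinarith [hn.trans hN]

theorem exists_check_runs (L : List (Atom β)) (hL : ∀ A ∈ L, A.col ≠ .row) :
    ∃ (P : Program (Alphabet β) (Control β)) (p : Polynomial ℕ), ∀ (m n N : ℕ) (a : Bool)
      (cnt : Counter → ℕ) (M : Mem β), n ≤ N → N ≤ m → cnt .tmp = 0 →
      (∀ r, values cnt r < bound n N r) →
      P.Runs (p.eval m) (conf (a, none) ⟨[], [], [], rows M n 0 N⟩ cnt)
        (conf (a && L.all fun A => M (values cnt A.row) (values cnt A.col) A.bit == A.val, none)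
          ⟨[], [], [], rows M n 0 N⟩ cnt) := by
  induction L with
  | nil =>
    refine ⟨.basic clearBuf, 1, fun m n N a cnt M _ _ _ _ => ?_⟩
    simpa using Program.runs_basic exec_clearBuf
  | cons A L ih =>
    obtain ⟨P, p, hP⟩ := ih fun B hB => hL B (List.mem_cons_of_mem A hB)
    obtain ⟨Q, q, hQ⟩ := exists_access_runs A.row (hL A List.mem_cons_self)
      fun c a => (c, a && (c A.bit == A.val))
    refine ⟨Q.seq P, q + p, fun m n N a cnt M hn hN htmp hlt => ?_⟩
    have hQ := hQ m n N a cnt M hn hN htmp hlt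
    rw [setCell_self] at hQ
    rw [Polynomial.eval_add, List.all_cons, ← Bool.and_assoc]
    exact hQ.seq (hP m n N _ cnt M hn hN htmp hlt)

section

variable [DecidableEq β]

theorem Rule.Legal.realizable {R : Rule β} (hR : R.Legal) :
    Realizable ∅ fun _ e M => R.apply e M := by
  obtain ⟨P, p, hP⟩ := exists_check_runs R.body hR.1
  obtain ⟨Q, q, hQ⟩ := exists_access_runs R.row hR.2
    fun c a => (if a then Function.update c R.bit true else c, true)
  refine ⟨P.seq Q, p + q, fun m n N cnt M hn hN htmp hlt _ => ?_⟩
  rw [Polynomial.eval_add]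
  have hrun := (hP m n N true cnt M hn hN htmp hlt).seq (hQ m n N _ cnt M hn hN htmp hlt)
  have hfires :
      (true && R.body.all fun A => M (values cnt A.row) (values cnt A.col) A.bit == A.val) =
        decide (R.Fires (values cnt) M) :=
    Bool.eq_iff_iff.2 (by
      rw [decide_eq_true_iff]
      simp only [Bool.true_and, List.all_eq_true, beq_iff_eq, Rule.Fires])
  rw [hfires] at hrun
  by_cases h : R.Fires (values cnt) M <;> simpa [Rule.apply, h, setCell_self] using hrun

/-- Apply a rule for all values of some registers. -/
def sweep (R : Rule β) : List Register → Transformation β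
  | [] => fun _ e M => R.apply e M
  | r :: l => forEach r (sweep R l)

theorem Rule.Legal.realizable_sweep {R : Rule β} (hR : R.Legal) {l : List Register}
    (hl : l.Nodup) : Realizable l.toFinset (sweep R l) := by
  induction l with
  | nil => exact hR.realizable
  | cons r l ih =>
    rw [List.nodup_cons] at hl
    rw [List.toFinset_cons]
    exact (ih hl.2).forEach (by simpa using hl.1)

/-- The values of the registers that a sweep goes through. -/
def envs (b : Register → ℕ) : List Register → (Register → ℕ) → List (Register → ℕ)
  | [], e => [e]
  | r :: l, e => (List.range (b r)).flatMap fun x => envs b l (Function.update e r x)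

variable {R : Rule β} {b e e' : Register → ℕ} {l : List Register} {M : Mem β} {t : β} {u v : ℕ}

theorem sweep_eq_foldl :
    sweep R l b e M = (envs b l e).foldl (fun M e => R.apply e M) M := by
  induction l generalizing e M with
  | nil => rfl
  | cons r l ih => simp only [sweep, forEach, envs, List.foldl_flatMap, ih]

theorem mem_envs (hl : l.Nodup) :
    e' ∈ envs b l e ↔ (∀ r ∈ l, e' r < b r) ∧ ∀ r ∉ l, e' r = e r := by
  induction l generalizing e with
  | nil => simp [envs, funext_iff]
  | cons r l ih =>
    rw [List.nodup_cons] at hl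
    simp only [envs, List.mem_flatMap, List.mem_range, ih hl.2, List.forall_mem_cons]
    constructor
    · rintro ⟨x, hx, hlt, heq⟩
      refine ⟨⟨by simpa [heq r hl.1] using hx, hlt⟩, fun r' hr' => ?_⟩
      rw [List.mem_cons, not_or] at hr'
      rw [heq r' hr'.2, Function.update_of_ne hr'.1]
    · rintro ⟨⟨hr, hlt⟩, heq⟩
      refine ⟨e' r, hr, hlt, fun r' hr' => ?_⟩
      by_cases h : r' = r
      · simp [h]
      · rw [Function.update_of_ne h, heq r' (by simp [h, hr'])]

theorem foldl_apply (hR : ∀ A ∈ R.body, A.bit ≠ R.bit) (L : List (Register → ℕ)) :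
    L.foldl (fun M e => R.apply e M) M u v t = true ↔
      M u v t = true ∨ ∃ e ∈ L, R.Fires e M ∧ u = e R.row ∧ v = e R.col ∧ t = R.bit := by
  induction L generalizing M with
  | nil => simp
  | cons e L ih =>
    have hfires (e' : Register → ℕ) : R.Fires e' (R.apply e M) ↔ R.Fires e' M :=
      forall₂_congr fun A hA => by
        have hbit : R.apply e M (e' A.row) (e' A.col) A.bit = M (e' A.row) (e' A.col) A.bit :=
          Bool.eq_iff_iff.2 (Rule.apply_apply.trans (by simp [hR A hA]))
        rw [hbit]
    simp only [List.foldl_cons, ih, hfires, Rule.apply_apply, List.exists_mem_cons_iff, or_assoc]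

/-- For a rule whose conclusion does not occur in its body, the order of the applications does not
matter. -/
theorem sweep_apply (hR : ∀ A ∈ R.body, A.bit ≠ R.bit) (hl : l.Nodup) :
    sweep R l b e M u v t = true ↔ M u v t = true ∨
      ∃ e' : Register → ℕ, (∀ r ∈ l, e' r < b r) ∧ (∀ r ∉ l, e' r = e r) ∧ R.Fires e' M ∧
        u = e' R.row ∧ v = e' R.col ∧ t = R.bit := by
  simp only [sweep_eq_foldl, foldl_apply hR, mem_envs hl, and_assoc]

theorem sweep_induction {p : Mem β → Prop} (hM : p M)
    (h : ∀ e' ∈ envs b l e, ∀ M, p M → p (R.apply e' M)) : p (sweep R l b e M) := by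
  rw [sweep_eq_foldl]
  exact List.foldlRecOn _ _ hM fun M hM e' he' => h e' he' M hM

theorem le_sweep : M ≤ sweep R l b e M :=
  sweep_induction le_rfl fun _ _ _ h => h.trans Rule.le_apply

theorem sweep_of_fires (hR : R.Positive) (he : e' ∈ envs b l e) (h : R.Fires e' M) :
    sweep R l b e M (e' R.row) (e' R.col) R.bit = true := by
  obtain ⟨L, L', hL⟩ := List.append_of_mem he
  have hle (L : List (Register → ℕ)) (M : Mem β) : M ≤ L.foldl (fun M e => R.apply e M) M :=
    List.foldlRecOn L _ (motive := fun M' => M ≤ M') le_rfl fun _ hM _ _ => hM.trans Rule.le_apply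
  rw [sweep_eq_foldl, hL, List.foldl_append, List.foldl_cons]
  exact Bool.le_iff_imp.1 (hle L' _ _ _ _)
    (Rule.apply_apply.2 (.inr ⟨hR.fires_mono (hle L M) h, rfl, rfl, rfl⟩))

end

section

variable [DecidableEq β] {R : Rule β} {b e : Register → ℕ} {l : List Register}
  {M : Mem β} {t : β} {u v : ℕ}

theorem sweep_of_ne (h : t ≠ R.bit) : sweep R l b e M u v t = M u v t :=
  sweep_induction (p := fun M' => M' u v t = M u v t) rfl fun _ _ _ hM' =>
    (Bool.eq_iff_iff.2 (Rule.apply_apply.trans (by simp [h]))).trans hM'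

/-- Perform a sequence of sweeps. -/
def sweepAll (L : List (Rule β × List Register)) : Transformation β :=
  fun b e M => L.foldl (fun M s => sweep s.1 s.2 b e M) M

theorem realizable_sweepAll {L : List (Rule β × List Register)}
    (hL : ∀ s ∈ L, s.1.Legal ∧ s.2.Nodup) : Realizable .univ (sweepAll L) := by
  induction L with
  | nil => exact .id
  | cons s L ih =>
    rw [List.forall_mem_cons] at hL
    exact (ih hL.2).comp ((hL.1.1.realizable_sweep hL.1.2).mono (Finset.subset_univ _))

theorem sweepAll_append (L L' : List (Rule β × List Register)) :
    sweepAll (L ++ L') b e M = sweepAll L' b e (sweepAll L b e M) :=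
  List.foldl_append

theorem sweepAll_of_ne {L : List (Rule β × List Register)} (h : ∀ s ∈ L, t ≠ s.1.bit) :
    sweepAll L b e M u v t = M u v t :=
  List.foldlRecOn (motive := fun M' : Mem β => M' u v t = M u v t) L _ rfl fun _ hM' s hs =>
    (sweep_of_ne (h s hs)).trans hM'

end

/-! ### Relations in the memory -/

/-- The register values with the given components. -/
def env (row i j k : ℕ) : Register → ℕ
  | .row => row
  | .i => i
  | .j => j
  | .k => k

theorem exists_env {p : (Register → ℕ) → Prop} : (∃ e, p e) ↔ ∃ row i j k, p (env row i j k) := by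
  refine ⟨fun ⟨e, he⟩ => ⟨e .row, e .i, e .j, e .k, ?_⟩, fun ⟨_, _, _, _, h⟩ => ⟨_, h⟩⟩
  convert he using 1
  funext r
  cases r <;> rfl

theorem Register.forall_iff {p : Register → Prop} : (∀ r, p r) ↔ p .row ∧ p .i ∧ p .j ∧ p .k :=
  ⟨fun h => ⟨h _, h _, h _, h _⟩, fun ⟨hrow, hi, hj, hk⟩ r => by cases r <;> assumption⟩

section

variable {n N : ℕ} {M : Mem β} {t : β} {T : Fin n → Fin n → Prop}

/-- The bit `t` of the cells in the first `n` rows and columns represents the relation `T`. -/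
def Represents (M : Mem β) (t : β) (T : Fin n → Fin n → Prop) : Prop :=
  ∀ u v : Fin n, M u v t = true ↔ T u v

variable [DecidableEq β]

/-- The reflexive closure of the relation that the bit `t` represents. -/
def reflRule (t : β) : Rule β :=
  ⟨[], .i, .i, t⟩

/-- The rule whose repeated application yields the transitive closure of the relation that the bit
`t` represents. -/
def transRule (t : β) : Rule β :=
  ⟨[⟨.i, .k, t, true⟩, ⟨.k, .j, t, true⟩], .i, .j, t⟩

theorem Represents.sweep_reflRule (hM : Represents M t T) :
    Represents (sweep (reflRule t) [.i] (bound n N) 0 M) t (Relation.ReflGen T) := by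
  intro u v
  rw [sweep_apply (by simp [reflRule]) (by simp), hM, Relation.reflGen_iff, or_comm]
  simp [exists_env, Register.forall_iff, env, reflRule, bound, Rule.Fires, Fin.ext_iff, eq_comm]

theorem transRule_of_warshall {x i j : ℕ} (hx : x ≤ n) (hi : i < n) (hj : j < n)
    (h : warshall (fun i j => M i j t = true) x i j) :
    (List.range x).foldl (fun M x => sweep (transRule t) [.i, .j] (bound n N)
      (Function.update 0 .k x) M) M i j t = true := by
  induction x generalizing i j with
  | zero => exact h
  | succ x ih =>
    rw [List.range_succ, List.foldl_append, List.foldl_cons, List.foldl_nil]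
    rcases h with h | ⟨hix, hxj⟩
    · exact Bool.le_iff_imp.1 (le_sweep i j t) (ih (by omega) hi hj h)
    · refine sweep_of_fires (R := transRule t) (e' := env 0 i j x) ?_ ?_ ?_
      · simp [Rule.Positive, transRule]
      · simp [mem_envs, Register.forall_iff, env, bound, hi, hj]
      · have hfires := And.intro (ih (Nat.le_of_succ_le hx) hi hx hix)
          (ih (Nat.le_of_succ_le hx) hx hj hxj)
        simpa [Rule.Fires, transRule, env] using hfires

theorem Represents.sweep_transRule (hM : Represents M t T) (hT : ∀ u, T u u) :
    Represents (sweep (transRule t) [.k, .i, .j] (bound n N) 0 M) t (Relation.ReflTransGen T) := by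
  intro u v
  constructor
  · refine sweep_induction (p := fun M' => ∀ u v : Fin n, M' u v t = true →
      Relation.ReflTransGen T u v) (fun u v h => .single ((hM u v).1 h)) ?_ u v
    intro e he M' hM' u v h
    rw [mem_envs (by simp)] at he
    have hk : e .k < n := he.1 .k (by simp)
    rcases Rule.apply_apply.1 h with h | ⟨hfires, hu, hv, -⟩
    · exact hM' u v h
    · simp only [Rule.Fires, transRule, List.forall_mem_cons] at hfires hu hv
      rw [← hu, ← hv] at hfires
      exact (hM' u ⟨e .k, hk⟩ hfires.1).trans (hM' ⟨e .k, hk⟩ v hfires.2.1)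
  · intro h
    exact transRule_of_warshall le_rfl u.2 v.2 (warshall_of_reflTransGen
      (fun u => (hM u u).2 (hT u)) (fun u v => (hM u v).2) h)

/-- Compute the reflexive transitive closure of the relation that the bit `t` represents. -/
def closure (t : β) : List (Rule β × List Register) :=
  [(reflRule t, [.i]), (transRule t, [.k, .i, .j])]

theorem Represents.sweepAll_closure (hM : Represents M t T) :
    Represents (sweepAll (closure t) (bound n N) 0 M) t (Relation.ReflTransGen T) := by
  rw [← Relation.reflTransGen_reflGen]
  exact hM.sweep_reflRule.sweep_transRule fun _ => .refl

end

/-! ### Deciding one-player games -/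

/-- The bits of a cell. Bits `color` and `start` say that the vertex of the column belongs to the
color of the row, and is the starting vertex. The other bits represent relations between the
vertices of the row and the column, or, on the diagonal, properties of a vertex; `failure` is only
used in the first cell. -/
inductive Bit
  | reach | start | color | eq | conflict | forces | doomed | failure
  deriving DecidableEq

instance : Fintype Bit :=
  ⟨{.reach, .start, .color, .eq, .conflict, .forces, .doomed, .failure}, by
    rintro (_ | _ | _ | _ | _ | _ | _ | _) <;> simp⟩

/-- The sweeps that compute the bit `conflict`. -/
def conflictSweeps : List (Rule Bit × List Register) :=
  [(⟨[⟨.i, .j, .reach, false⟩, ⟨.j, .i, .reach, false⟩], .i, .j, .conflict⟩, [.i, .j]),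
    (⟨[⟨.row, .k, .start, true⟩, ⟨.k, .i, .reach, false⟩], .i, .j, .conflict⟩, [.i, .j, .k, .row]),
    (⟨[⟨.row, .k, .start, true⟩, ⟨.k, .j, .reach, false⟩], .i, .j, .conflict⟩, [.i, .j, .k, .row])]

/-- The sweep that computes the bit `forces` for single steps. -/
def forcesSweep : Rule Bit × List Register :=
  (⟨[⟨.row, .j, .color, true⟩, ⟨.row, .k, .color, true⟩, ⟨.j, .k, .eq, false⟩,
    ⟨.i, .j, .conflict, true⟩], .i, .k, .forces⟩, [.i, .j, .k, .row])

/-- The sweep that computes the bit `doomed`. -/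
def doomedSweep : Rule Bit × List Register :=
  (⟨[⟨.i, .j, .forces, true⟩, ⟨.i, .j, .conflict, true⟩], .i, .i, .doomed⟩, [.i, .j])

/-- The sweep that looks for a color all of whose vertices are doomed. -/
def failureSweep : Rule Bit × List Register :=
  (⟨[⟨.row, .i, .color, true⟩, ⟨.row, .j, .color, true⟩, ⟨.i, .j, .eq, false⟩,
    ⟨.i, .i, .doomed, true⟩, ⟨.j, .j, .doomed, true⟩], .k, .k, .failure⟩, [.i, .j, .row])

/-- The decision procedure. -/
def solve : List (Rule Bit × List Register) :=
  closure .reach ++ conflictSweeps ++ [(reflRule .eq, [.i])] ++ [forcesSweep] ++ closure .forces ++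
    [doomedSweep] ++ [failureSweep]

theorem realizable_solve : Realizable .univ (sweepAll solve) :=
  realizable_sweepAll (by decide)

/-- The memory with an input: the adjacency matrix, the reachability sets and the starting
vertex. -/
noncomputable def inputMem (I : GenReachInput) : Mem Bit := by
  classical
  exact fun i j t => decide <| match t with
    | .reach => ∃ u v, I.arena.edge u v ∧ i = u ∧ j = v
    | .color => ∃ c, ∃ v ∈ I.target c, i = I.n + c ∧ j = v
    | .start => i = I.n + I.k ∧ j = I.start
    | _ => False

section

variable {n k N : ℕ} {M : Mem Bit} {u v s : Fin n} {R C : Fin n → Fin n → Prop}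
  {F : Fin k → Set (Fin n)}

theorem represents_conflictSweeps (hreach : Represents M .reach R)
    (hstart : ∀ i j, M i j .start = true ↔ i = n + k ∧ j = s) (hN : n + k < N)
    (hconflict : ∀ i j, M i j .conflict = false) :
    Represents (sweepAll conflictSweeps (bound n N) 0 M) .conflict
      fun u v => (¬ R u v ∧ ¬ R v u) ∨ ¬ R s u ∨ ¬ R s v := by
  have hunreach (u v : Fin n) : M u v .reach = false ↔ ¬ R u v := by
    rw [← hreach, Bool.not_eq_true]
  intro u v
  simp only [sweepAll, conflictSweeps, List.foldl_cons, List.foldl_nil]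
  rw [sweep_apply (by simp) (by simp), sweep_apply (by simp) (by simp),
    sweep_apply (by simp) (by simp)]
  simp [exists_env, Register.forall_iff, env, bound, Rule.Fires, hconflict,
    sweep_of_ne, hstart, hN, hunreach, or_assoc]

theorem represents_forcesSweep (hconflict : Represents M .conflict C)
    (hdiag : Represents M .eq (@Eq (Fin n)))
    (hcolor : ∀ i j, M i j .color = true ↔ ∃ c : Fin k, ∃ v ∈ F c, i = n + c ∧ j = v)
    (hN : n + k < N) (hforces : ∀ i j, M i j .forces = false) :
    Represents (sweepAll [forcesSweep] (bound n N) 0 M) .forces (Forces C F) := by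
  have hne (u v : Fin n) : M u v .eq = false ↔ u ≠ v := by
    rw [← Bool.not_eq_true, hdiag]
  have hlt (c : Fin k) : n + c < N := by omega
  intro t w
  simp only [sweepAll, forcesSweep, List.foldl_cons, List.foldl_nil]
  rw [sweep_apply (by simp) (by simp)]
  simp [exists_env, Register.forall_iff, env, bound, Rule.Fires, hforces, hcolor, hlt, hne,
    Fin.val_inj, hconflict _ _, Forces]

theorem doomedSweep_iff (hforces : Represents M .forces R) (hconflict : Represents M .conflict C)
    (hdoomed : ∀ i j, M i j .doomed = false) :
    sweepAll [doomedSweep] (bound n N) 0 M u u .doomed = true ↔ ∃ v, R u v ∧ C u v := by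
  simp only [sweepAll, doomedSweep, List.foldl_cons, List.foldl_nil]
  rw [sweep_apply (by simp) (by simp)]
  simp [exists_env, Register.forall_iff, env, bound, Rule.Fires, hdoomed, ← hforces u,
    ← hconflict u, Fin.exists_iff, and_assoc, and_comm, and_left_comm]

theorem failureSweep_iff {P : Fin n → Prop} (hdoomed : ∀ v : Fin n, M v v .doomed = true ↔ P v)
    (hdiag : Represents M .eq (@Eq (Fin n)))
    (hcolor : ∀ i j, M i j .color = true ↔ ∃ c : Fin k, ∃ v ∈ F c, i = n + c ∧ j = v)
    (hN : n + k < N) (hfailure : M 0 0 .failure = false) :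
    sweepAll [failureSweep] (bound n N) 0 M 0 0 .failure = true ↔
      ∃ c, ∃ u ∈ F c, ∃ v ∈ F c, u ≠ v ∧ P u ∧ P v := by
  have hne (u v : Fin n) : M u v .eq = false ↔ u ≠ v := by
    rw [← Bool.not_eq_true, hdiag]
  have hlt (c : Fin k) : n + c < N := by omega
  simp only [sweepAll, failureSweep, List.foldl_cons, List.foldl_nil]
  rw [sweep_apply (by simp) (by simp)]
  simp [exists_env, Register.forall_iff, env, bound, Rule.Fires, hfailure, hcolor, hlt, hne,
    Fin.val_inj, hdoomed]

variable {I : GenReachInput} {b e : Register → ℕ} {L : List (Rule Bit × List Register)}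

theorem sweepAll_inputMem_color (hL : ∀ s ∈ L, .color ≠ s.1.bit) (i j : ℕ) :
    sweepAll L b e (inputMem I) i j .color = true ↔
      ∃ c, ∃ v ∈ I.target c, i = I.n + c ∧ j = v := by
  rw [sweepAll_of_ne hL]
  simp [inputMem]

theorem sweepAll_inputMem_start (hL : ∀ s ∈ L, .start ≠ s.1.bit) (i j : ℕ) :
    sweepAll L b e (inputMem I) i j .start = true ↔ i = I.n + I.k ∧ j = I.start := by
  rw [sweepAll_of_ne hL]
  simp [inputMem]

theorem sweepAll_inputMem_eq_false {t : Bit} (hL : ∀ s ∈ L, t ≠ s.1.bit)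
    (ht : t ∉ [.reach, .color, .start]) (i j : ℕ) :
    sweepAll L b e (inputMem I) i j t = false := by
  rw [sweepAll_of_ne hL]
  cases t <;> simp_all [inputMem]

theorem represents_conflict (hN : I.n + I.k < N) :
    Represents (sweepAll (closure .reach ++ conflictSweeps) (bound I.n N) 0 (inputMem I)) .conflict
      (I.arena.Conflict I.start) := by
  have hinput : Represents (inputMem I) .reach I.arena.edge := fun u v => by
    simp [inputMem, Fin.val_inj]
  rw [sweepAll_append]
  exact represents_conflictSweeps hinput.sweepAll_closure (sweepAll_inputMem_start (by decide)) hN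
    (sweepAll_inputMem_eq_false (by decide) (by decide))

theorem represents_eq (hM : ∀ i j, M i j .eq = false) :
    Represents (sweepAll [(reflRule .eq, [.i])] (bound n N) 0 M) .eq (@Eq (Fin n)) := by
  have hempty : Represents M .eq fun _ _ : Fin n => False := fun u v => by simp [hM]
  intro u v
  exact (hempty.sweep_reflRule u v).trans (by simp [Relation.reflGen_iff, eq_comm])

theorem represents_forces (hN : I.n + I.k < N) :
    Represents (sweepAll (closure .reach ++ conflictSweeps ++ [(reflRule .eq, [.i])] ++
      [forcesSweep] ++ closure .forces) (bound I.n N) 0 (inputMem I)) .forces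
      (Relation.ReflTransGen (Forces (I.arena.Conflict I.start) I.target)) := by
  rw [sweepAll_append, sweepAll_append]
  refine Represents.sweepAll_closure (represents_forcesSweep (fun u v => ?_) ?_
    (sweepAll_inputMem_color (by decide)) hN (sweepAll_inputMem_eq_false (by decide) (by decide)))
  · rw [sweepAll_append, sweepAll_of_ne (by decide)]
    exact represents_conflict hN u v
  · rw [sweepAll_append]
    exact represents_eq (sweepAll_inputMem_eq_false (by decide) (by decide))

theorem sweepAll_solve_inputMem (hN : I.n + I.k < N) :
    sweepAll solve (bound I.n N) 0 (inputMem I) 0 0 .failure = true ↔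
      ∃ c, ∃ u ∈ I.target c, ∃ v ∈ I.target c, u ≠ v ∧
        IsDoomed (I.arena.Conflict I.start) I.target u ∧
        IsDoomed (I.arena.Conflict I.start) I.target v := by
  rw [solve, sweepAll_append]
  refine failureSweep_iff (fun v => ?_) ?_ (sweepAll_inputMem_color (by decide)) hN
    (sweepAll_inputMem_eq_false (by decide) (by decide) 0 0)
  · rw [sweepAll_append]
    refine doomedSweep_iff (represents_forces hN) (fun u v => ?_)
      (sweepAll_inputMem_eq_false (by decide) (by decide))
    rw [sweepAll_append, sweepAll_of_ne (by decide), sweepAll_append, sweepAll_of_ne (by decide),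
      sweepAll_append, sweepAll_of_ne (by decide)]
    exact represents_conflict hN u v
  · intro u v
    rw [sweepAll_append, sweepAll_of_ne (by decide), sweepAll_append, sweepAll_of_ne (by decide),
      sweepAll_append, sweepAll_of_ne (by decide), sweepAll_append]
    exact represents_eq (sweepAll_inputMem_eq_false (by decide) (by decide)) u v

theorem eveWins_iff_sweepAll_solve (hI : I.arena.IsOnePlayer) (hF : ∀ c, (I.target c).ncard = 2)
    (hN : I.n + I.k < N) :
    I.EveWins ↔ sweepAll solve (bound I.n N) 0 (inputMem I) 0 0 .failure = false := by
  rw [GenReachInput.EveWins, hI.eveWins_genReach_iff,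
    exists_isConflictFreeTransversal_iff (fun _ _ => Arena.Conflict.symm) hF, ← Bool.not_eq_true,
    sweepAll_solve_inputMem hN, not_exists]
  refine forall_congr' fun c => ?_
  constructor
  · rintro ⟨w, hw, hnot⟩ ⟨u, hu, v, hv, huv, hdu, hdv⟩
    obtain ⟨w', -, -, hpair⟩ := exists_ne_forall_eq_or_eq (hF c) hw
    rcases hpair u hu with rfl | rfl
    · exact hnot hdu
    · exact hnot ((hpair v hv).resolve_right huv.symm ▸ hdv)
  · intro h
    by_contra! hdoomed
    obtain ⟨u, v, huv, hset⟩ := Set.ncard_eq_two.1 (hF c)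
    have hu : u ∈ I.target c := by simp [hset]
    have hv : v ∈ I.target c := by simp [hset]
    exact h ⟨u, hu, v, hv, huv, hdoomed u hu, hdoomed v hv⟩

end

/-! ### Reading the input and writing the answer -/

/-- Pop a letter of the input into the buffer, translating bits to cells. -/
def popInput (f : Bool → Cell β) : Line β :=
  .pop .inp (fun v x => (v.1, x.map (Option.map f))) .halt

/-- Append the bits up to the next separator of the input to the memory, as a row. -/
def readRow (f : Bool → Cell β) : Program (Alphabet β) (Control β) :=
  .seq (.whileDo (popInput f) holdsCell (.basic pushLeft)) (.basic pushLeft)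

/-- Append rows to the memory, up to an empty row or the end of the input. -/
def readRows (f : Bool → Cell β) : Program (Alphabet β) (Control β) :=
  .seq (.whileDo (popInput f) holdsCell
    (.seq (.basic pushLeft) (.seq (readRow f) (.basic (increment (.down .row))))))
    (.basic clearBuf)

/-- Set the number of columns to the number of bits up to the next separator of the input. -/
def readLength : Program (Alphabet β) (Control β) :=
  .seq (.whileDo (popInput fun _ _ => false) holdsCell
    (.seq (.basic (increment (.down .i)))
      (.seq (.basic (increment (.down .j))) (.basic (increment (.down .k))))))
    (.basic clearBuf)

/-- Read the last row of the memory. -/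
def readLastRow (f : Bool → Cell β) : Program (Alphabet β) (Control β) :=
  .seq (readRow f) (.seq (.basic (increment (.down .row))) rewind)

/-- Read two blocks of rows that precede the row under the head. -/
def readBlocks (f g : Bool → Cell β) : Program (Alphabet β) (Control β) :=
  .seq (readRows f) (.seq (readRows g) rewind)

/-- Read a word that sets the number of columns, the last row, and two blocks of further rows. -/
def load (f₀ f₁ f₂ : Bool → Cell β) : Program (Alphabet β) (Control β) :=
  .seq readLength (.seq (readLastRow f₀) (readBlocks f₁ f₂))

/-- The counters for `N` rows and `n` columns when all registers are zero. -/
def initCounters (n N : ℕ) : Counter → ℕ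
  | .down r => bound n N r
  | _ => 0

section

variable {a : Bool} {b : Option (Sym β)} {w : List (Option Bool)} {o : List Bool}
  {l r : List (Sym β)} {cnt : Counter → ℕ} {n N : ℕ} {f : Bool → Cell β}

@[simp] theorem exec_popInput : Program.exec (popInput f) (conf (a, b) ⟨w, o, l, r⟩ cnt) =
    conf (a, w.head?.map (Option.map f)) ⟨w.tail, o, l, r⟩ cnt := by
  simp [Program.exec, popInput]

theorem runs_increment_row : (Program.basic (increment (.down .row))).Runs 1
    (conf (a, none) ⟨w, o, l, r⟩ (initCounters n N))
    (conf (a, none) ⟨w, o, l, r⟩ (initCounters n (N + 1))) := by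
  refine Program.runs_basic ((exec_increment _).trans (congrArg _ (funext ?_)))
  rintro (_ | _ | _ | _ | _ | _) <;> simp [initCounters, bound]

theorem runs_increment_columns : (Program.seq (.basic (increment (.down .i)))
      (.seq (.basic (increment (.down .j))) (.basic (increment (.down .k))))).Runs 3
    (conf (a, b) ⟨w, o, l, r⟩ (initCounters n 0))
    (conf (a, none) ⟨w, o, l, r⟩ (initCounters (n + 1) 0)) := by
  have hrun := (Program.runs_basic (exec_increment (a := a) (b := b) (T := ⟨w, o, l, r⟩)
    (cnt := initCounters n 0) (.down .i))).seq ((Program.runs_basic (exec_increment (.down .j))).seq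
      (Program.runs_basic (exec_increment (.down .k))))
  convert hrun using 3
  funext c
  rcases c with _ | _ | _ | _ | _ | _ <;> simp [initCounters, bound]

theorem runs_readLength (s : List Bool) (w : List (Option Bool)) :
    readLength.Runs (s.length * 4 + 2)
      (conf (a, none) ⟨s.map some ++ none :: w, o, l, r⟩ (initCounters 0 0))
      (conf (a, none) ⟨w, o, l, r⟩ (initCounters s.length 0)) := by
  have hloop := Program.runs_whileDo_list (q := popInput fun _ (_ : β) => false) (test := holdsCell)
    (fun s n => conf (a, none) ⟨s.map some ++ none :: w, o, l, r⟩ (initCounters n 0))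
    (fun n _ => n + 1) 3
    (fun x s n => ⟨by simp, by simpa using runs_increment_columns⟩)
    (fun n => by simp) s 0
  simpa [readLength] using hloop.seq (Program.runs_basic (by simp))

theorem runs_readRow (s : List Bool) (w : List (Option Bool)) :
    (readRow f).Runs (s.length * 2 + 2)
      (conf (a, none) ⟨s.map some ++ none :: w, o, l, r⟩ cnt)
      (conf (a, none) ⟨w, o, none :: ((s.map fun x => some (f x)).reverse ++ l), r⟩ cnt) := by
  have hloop := Program.runs_whileDo_list (q := popInput f) (test := holdsCell)
    (P := .basic pushLeft)
    (fun s l => conf (a, none) ⟨s.map some ++ none :: w, o, l, r⟩ cnt)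
    (fun l x => some (f x) :: l) 1
    (fun x s l => ⟨by simp, Program.runs_basic (by simp)⟩)
    (fun l => by simp) s l
  simpa [readRow] using hloop.seq (Program.runs_basic (q := pushLeft)
    (c' := conf (a, none) ⟨w, o, none :: ((s.map fun x => some (f x)).reverse ++ l), r⟩ cnt)
    (by simp))

theorem runs_whileDo_popInput {P : Program (Alphabet β) (Control β)} (hw : w.head?.join = none) :
    (Program.whileDo (popInput f) holdsCell P).Runs 1 (conf (a, none) ⟨w, o, l, r⟩ cnt)
      (conf (a, w.head?.map (Option.map f)) ⟨w.tail, o, l, r⟩ cnt) := by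
  have htest : holdsCell (a, w.head?.map (Option.map f)) = false := by
    rcases w with _ | ⟨_ | _, _⟩ <;> simp_all
  simpa using Program.runs_whileDo_of_false (q := popInput f) (test := holdsCell)
    (c := conf (a, none) ⟨w, o, l, r⟩ cnt) (by simpa using htest)

theorem runs_readRows (hn : 0 < n) {L : List (List Bool)} (hL : ∀ s ∈ L, s.length = n)
    (hw : w.head?.join = none) :
    (readRows f).Runs (L.length * (2 * n + 5) + 2)
      (conf (a, none) ⟨joinRows L ++ w, o, l, r⟩ (initCounters n N))
      (conf (a, none) ⟨w.tail, o, (joinRows (L.map (List.map f))).reverse ++ l, r⟩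
        (initCounters n (N + L.length))) := by
  suffices h : (Program.whileDo (popInput f) holdsCell
      (.seq (.basic pushLeft) (.seq (readRow f) (.basic (increment (.down .row)))))).Runs
        (L.length * (2 * n + 5) + 1)
        (conf (a, none) ⟨joinRows L ++ w, o, l, r⟩ (initCounters n N))
        (conf (a, w.head?.map (Option.map f))
          ⟨w.tail, o, (joinRows (L.map (List.map f))).reverse ++ l, r⟩
          (initCounters n (N + L.length))) from
    h.seq (Program.runs_basic exec_clearBuf)
  induction L generalizing l N with
  | nil => simpa [joinRows] using runs_whileDo_popInput hw
  | cons s L ih =>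
    obtain ⟨hs, hrows⟩ := List.forall_mem_cons.1 hL
    obtain ⟨x, s, rfl⟩ := List.exists_cons_of_length_pos (hs.symm ▸ hn)
    rw [List.length_cons] at hs
    have hrest := ih (l := none :: ((s.map fun x => some (f x)).reverse ++ some (f x) :: l))
      (N := N + 1) hrows
    have hbody := (Program.runs_basic (exec_pushLeft (some (f x)))).seq
      ((runs_readRow (f := f) (a := a) (o := o) (l := some (f x) :: l) (r := r)
        (cnt := initCounters n N) s (joinRows L ++ w)).seq runs_increment_row)
    have hrun := Program.runs_whileDo_of_true (q := popInput f) (test := holdsCell)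
      (c := conf (a, none) ⟨joinRows ((x :: s) :: L) ++ w, o, l, r⟩ (initCounters n N))
      (by simp [joinRows_cons]) (by simpa [joinRows_cons] using hbody) hrest
    have htime : 1 + (s.length * 2 + 2 + 1) + 1 + (L.length * (2 * n + 5) + 1) ≤
        (L.length + 1) * (2 * n + 5) + 1 := by
      nlinarith
    simpa [joinRows_cons, Function.comp_def, add_assoc, add_comm 1 L.length] using hrun.mono htime

theorem runs_readLastRow (s : List Bool) (w : List (Option Bool)) :
    (readLastRow f).Runs (s.length * 4 + 6)
      (conf (a, none) ⟨s.map some ++ none :: w, o, [], []⟩ (initCounters n N))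
      (conf (a, none) ⟨w, o, [], joinRows [s.map f]⟩ (initCounters n (N + 1))) := by
  have hrun := (runs_readRow (f := f) (a := a) (o := o) (l := []) (r := []) s w).seq
    (runs_increment_row.seq (runs_rewind (cnt := initCounters n (N + 1)) []))
  have htime : s.length * 2 + 2 + (1 + ((s.length + 1) * 2 + 1)) ≤ s.length * 4 + 6 := by omega
  simpa [readLastRow, joinRows, Function.comp_def] using hrun.mono (by simpa using htime)

theorem length_joinRows_map {L : List (List Bool)} (hL : ∀ s ∈ L, s.length = n) :
    (joinRows (L.map (List.map f))).length = L.length * (n + 1) := by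
  rw [length_joinRows (n := n) (by simpa using hL), List.length_map]

theorem runs_readBlocks {L₁ L₂ : List (List Bool)} (hn : 0 < n) (hL₁ : ∀ s ∈ L₁, s.length = n)
    (hL₂ : ∀ s ∈ L₂, s.length = n) (f₁ f₂ : Bool → Cell β) :
    (readBlocks f₁ f₂).Runs ((L₁.length + L₂.length) * (4 * n + 7) + 5)
      (conf (a, none) ⟨joinRows L₁ ++ none :: joinRows L₂, o, [], r⟩ (initCounters n N))
      (conf (a, none)
        ⟨[], o, [], joinRows (L₁.map (List.map f₁) ++ L₂.map (List.map f₂)) ++ r⟩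
        (initCounters n (N + L₁.length + L₂.length))) := by
  have hblock₁ := runs_readRows (f := f₁) (a := a) (o := o) (l := []) (r := r) (N := N)
    (w := none :: joinRows L₂) hn hL₁ rfl
  have hblock₂ := runs_readRows (f := f₂) (a := a) (o := o) (r := r) (N := N + L₁.length)
    (l := (joinRows (L₁.map (List.map f₁))).reverse) (w := []) hn hL₂ rfl
  have hrewind := runs_rewind (a := a) (w := []) (o := o)
    (cnt := initCounters n (N + L₁.length + L₂.length))
    (l := (joinRows (L₂.map (List.map f₂))).reverse ++ (joinRows (L₁.map (List.map f₁))).reverse) r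
  rw [List.append_nil] at hblock₁ hblock₂
  have hrun := hblock₁.seq (hblock₂.seq hrewind)
  rw [List.length_append, List.length_reverse, List.length_reverse, length_joinRows_map hL₁,
    length_joinRows_map hL₂, List.reverse_append, List.reverse_reverse, List.reverse_reverse,
    ← joinRows_append] at hrun
  exact hrun.mono (by linarith)

theorem runs_load {s₀ s₁ : List Bool} {L₁ L₂ : List (List Bool)} (hn : 0 < n)
    (hs₀ : s₀.length = n) (hs₁ : s₁.length = n) (hL₁ : ∀ s ∈ L₁, s.length = n)
    (hL₂ : ∀ s ∈ L₂, s.length = n) (f₀ f₁ f₂ : Bool → Cell β) :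
    (load f₀ f₁ f₂).Runs ((L₁.length + L₂.length) * (4 * n + 7) + 8 * n + 13)
      (conf (a, none) ⟨s₀.map some ++ none :: (s₁.map some ++ none :: (joinRows L₁ ++
        none :: joinRows L₂)), o, [], []⟩ (initCounters 0 0))
      (conf (a, none) ⟨[], o, [], joinRows (L₁.map (List.map f₁) ++ L₂.map (List.map f₂) ++
        [s₁.map f₀])⟩ (initCounters n (L₁.length + L₂.length + 1))) := by
  have hrun := (runs_readLength (β := β) (a := a) (o := o) (l := []) (r := []) s₀ _).seq
    ((runs_readLastRow (f := f₀) (N := 0) s₁ (joinRows L₁ ++ none :: joinRows L₂)).seq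
      (hs₀.symm ▸ runs_readBlocks hn hL₁ hL₂ f₁ f₂))
  rw [hs₀, hs₁, ← joinRows_append, zero_add, add_assoc 1, add_comm 1 (_ + _)] at hrun
  exact hrun.mono (by linarith)

end

/-- Set a counter to zero. -/
def resetCounter (c : Counter) : Program (Alphabet β) (Control β) :=
  .whileDo (decrement c) (fun v => v.2.isSome) (.basic clearBuf)

/-- Set all registers to zero, with no values to run through. -/
def resetRegisters : Program (Alphabet β) (Control β) :=
  .seq (resetCounter (.down .row)) (.seq (resetCounter (.down .i))
    (.seq (resetCounter (.down .j)) (resetCounter (.down .k))))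

/-- Clear the memory under and to the right of the head. -/
def clearMemory : Program (Alphabet β) (Control β) :=
  .whileDo popRight (fun v => v.2.isSome) (.basic clearBuf)

/-- Write the flag to the output, and set it. -/
def writeFlag : Line β :=
  .push .out (fun v => v.1) (.load (fun v => (true, v.2)) .halt)

/-- Write the negation of the bit `t` of the first cell, and clear the memory and the counters. -/
def answer (t : β) : Program (Alphabet β) (Control β) :=
  .seq (access .i .i fun c _ => (c, !c t))
    (.seq (.basic writeFlag) (.seq clearMemory resetRegisters))

section

variable {a : Bool} {T : Tapes β} {w : List (Option Bool)} {o : List Bool}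
  {l : List (Sym β)} {cnt : Counter → ℕ} {n N : ℕ}

theorem runs_resetCounter (c : Counter) :
    (resetCounter c).Runs (cnt c * 2 + 1) (conf (a, none) T cnt)
      (conf (a, none) T (Function.update cnt c 0)) := by
  have hloop := Program.runs_whileDo_range (q := decrement c) (test := fun v => v.2.isSome)
    (P := .basic clearBuf)
    (fun x => conf (a, none) T (Function.update cnt c (cnt c - x))) (cnt c) 1
    (fun x hx => ?_) ?_
  · rw [exec_decrement_of_zero (by simp)] at hloop
    simpa [resetCounter] using hloop
  · have hpos : cnt c - x ≠ 0 := by omega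
    refine ⟨by simp [exec_decrement, hpos], Program.runs_basic ?_⟩
    simp [exec_decrement, Nat.sub_sub]
  · simp [exec_decrement_of_zero]

theorem runs_resetRegisters : resetRegisters.Runs (N * 2 + n * 6 + 4)
    (conf (a, none) T (initCounters n N)) (conf (a, none) T (initCounters 0 0)) := by
  have hzero : Function.update (Function.update (Function.update (Function.update
      (initCounters n N) (.down .row) 0) (.down .i) 0) (.down .j) 0) (.down .k) 0 =
      initCounters 0 0 := by
    funext c
    rcases c with _ | _ | _ | _ | _ | _ <;> simp [initCounters, bound]
  have hrun := (runs_resetCounter (T := T) (a := a) (cnt := initCounters n N) (.down .row)).seq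
    ((runs_resetCounter (.down .i)).seq
      ((runs_resetCounter (.down .j)).seq (runs_resetCounter (.down .k))))
  rw [hzero] at hrun
  have htime : N * 2 + 1 + (n * 2 + 1 + (n * 2 + 1 + (n * 2 + 1))) ≤ N * 2 + n * 6 + 4 := by omega
  exact hrun.mono (by simpa [initCounters, bound] using htime)

theorem runs_clearMemory (r : List (Sym β)) :
    clearMemory.Runs (r.length * 2 + 1) (conf (a, none) ⟨w, o, l, r⟩ cnt)
      (conf (a, none) ⟨w, o, l, []⟩ cnt) := by
  have hloop := Program.runs_whileDo_list (q := popRight)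
    (test := fun v : Control β => v.2.isSome) (P := .basic clearBuf)
    (fun r (_ : Unit) => conf (a, none) ⟨w, o, l, r⟩ cnt) (fun _ _ => ()) 1
    (fun x r _ => ⟨by simp, Program.runs_basic (by simp)⟩) (fun _ => by simp) r ()
  simpa [clearMemory] using hloop

theorem runs_answer (hn : 0 < n) (hN : 0 < N) (M : Mem β) (t : β) :
    (answer t).Runs (N * (6 * n + 15) + 17 * n + 12) (rep n N (initCounters n N) M)
      (conf (true, none) ⟨[], [!M 0 0 t], [], []⟩ (initCounters 0 0)) := by
  have haccess := runs_access (a := true) (w := []) (o := []) (M := M) (r := .i) (s := .i)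
    (cnt := initCounters n N) (fun c _ => (c, !c t)) rfl hN hn
  have hwrite : Program.exec writeFlag (conf (!M 0 0 t, none) ⟨[], [], [], rows M n 0 N⟩
      (initCounters n N)) =
      conf (true, none) ⟨[], [!M 0 0 t], [], rows M n 0 N⟩ (initCounters n N) := by
    simp [Program.exec, writeFlag]
  have hclear := (runs_clearMemory (a := true) (w := []) (o := [!M 0 0 t]) (l := [])
    (cnt := initCounters n N) (rows M n 0 N)).seq runs_resetRegisters
  rw [length_rows, Nat.sub_zero] at hclear
  have hrun := haccess.seq
    ((Program.runs_basic (by simpa [initCounters, setCell_self] using hwrite)).seq hclear)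
  exact hrun.mono (by linarith)

end

/-- The cell in which only the bit `t` may be set. -/
def bitCell [DecidableEq β] (t : β) (b : Bool) : Cell β :=
  Function.update (fun _ => false) t b

open Classical in
/-- The characteristic vector of a set of vertices. -/
noncomputable def bitVector {n : ℕ} (S : Set (Fin n)) : List Bool :=
  List.ofFn fun v => decide (v ∈ S)

theorem length_bitVector {n : ℕ} (S : Set (Fin n)) : (bitVector S).length = n := by
  simp [bitVector]

theorem flatten_encodeSet {n m : ℕ} (F : Fin m → Set (Fin n)) :
    (List.ofFn fun i => GenReachInput.encodeSet (F i)).flatten =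
      joinRows (List.ofFn fun i => bitVector (F i)) := by
  simp [joinRows, GenReachInput.encodeSet, bitVector, List.flatMap_def, List.map_ofFn,
    Function.comp_def]

theorem encode_eq (I : GenReachInput) :
    I.encode = (bitVector I.arena.eve).map some ++ none ::
      ((bitVector {I.start}).map some ++ none ::
        (joinRows (List.ofFn fun u => bitVector {v | I.arena.edge u v}) ++ none ::
          joinRows (List.ofFn fun i => bitVector (I.target i)))) := by
  rw [GenReachInput.encode, flatten_encodeSet, flatten_encodeSet]
  simp [GenReachInput.encodeSet, bitVector, List.map_ofFn, Function.comp_def]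

theorem add_lt_length_encode (I : GenReachInput) : I.n + I.k < I.encode.length := by
  simp only [GenReachInput.encode, List.length_append, GenReachInput.encodeSet_length,
    GenReachInput.length_flatten_encodeSet]
  nlinarith [Nat.zero_le (I.n * I.n), Nat.zero_le (I.k * I.n)]

open Classical in
theorem rows_eq_joinRows [DecidableEq β] {M : Mem β} {n s m : ℕ} {t : β}
    {F : Fin m → Set (Fin n)}
    (hM : ∀ (i : Fin m) (j : Fin n), M (s + i) j = bitCell t (decide (j ∈ F i))) :
    rows M n s (s + m) =
      joinRows ((List.ofFn fun i => bitVector (F i)).map (List.map (bitCell t))) := by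
  rw [rows, Nat.add_sub_cancel_left]
  refine congrArg joinRows (List.ext_getElem (by simp) fun i hi _ => ?_)
  have him : i < m := by simpa using hi
  refine List.ext_getElem (by simp [length_bitVector]) fun j hj _ => ?_
  have hjn : j < n := by simpa using hj
  simpa [cells, bitVector] using hM ⟨i, him⟩ ⟨j, hjn⟩

theorem rows_inputMem (I : GenReachInput) : rows (inputMem I) I.n 0 (I.n + I.k + 1) = joinRows
    ((List.ofFn fun u => bitVector {v | I.arena.edge u v}).map (List.map (bitCell .reach)) ++
      (List.ofFn fun i => bitVector (I.target i)).map (List.map (bitCell .color)) ++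
      [(bitVector {I.start}).map (bitCell .start)]) := by
  have hedges := rows_eq_joinRows (M := inputMem I) (s := 0) (t := .reach)
    (F := fun u => {v | I.arena.edge u v}) fun u v => by
      funext t
      have hne (c : ℕ) : (u : ℕ) ≠ I.n + c := by omega
      cases t <;> simp [inputMem, bitCell, Fin.val_inj, hne]
  have htargets := rows_eq_joinRows (M := inputMem I) (s := I.n) (t := .color)
    (F := I.target) fun c v => by
      funext t
      have hne (u : Fin I.n) : I.n + c ≠ (u : ℕ) := by omega
      cases t <;> simp [inputMem, bitCell, Fin.val_inj, hne, c.2.ne]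
  have hstart := rows_eq_joinRows (M := inputMem I) (s := I.n + I.k) (t := .start) (m := 1)
    (F := fun _ => {I.start}) fun c v => by
      funext t
      have hne (u : Fin I.n) : I.n + I.k ≠ (u : ℕ) := by omega
      have hne' (c : Fin I.k) : I.k ≠ c := c.2.ne'
      cases t <;> simp [inputMem, bitCell, Fin.val_inj, hne, hne']
  rw [zero_add] at hedges
  rw [← rows_append (m := I.n + I.k) (Nat.zero_le _) (Nat.le_succ _),
    ← rows_append (m := I.n) I.n.zero_le (Nat.le_add_right ..), hedges, htargets, hstart,
    joinRows_append, joinRows_append]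
  simp

theorem runs_load_encode (I : GenReachInput) :
    (load (bitCell .start) (bitCell .reach) (bitCell .color)).Runs
      ((I.n + I.k) * (4 * I.n + 7) + 8 * I.n + 13)
      (conf (true, none) ⟨I.encode, [], [], []⟩ (initCounters 0 0))
      (rep I.n (I.n + I.k + 1) (initCounters I.n (I.n + I.k + 1)) (inputMem I)) := by
  have hload := runs_load (a := true) (o := []) (n := I.n) I.start.pos
    (length_bitVector I.arena.eve) (length_bitVector {I.start})
    (L₁ := List.ofFn fun u => bitVector {v | I.arena.edge u v})
    (L₂ := List.ofFn fun i => bitVector (I.target i))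
    (by simp [List.mem_ofFn, length_bitVector]) (by simp [List.mem_ofFn, length_bitVector])
    (bitCell .start) (bitCell .reach) (bitCell Bit.color)
  rw [← encode_eq, ← rows_inputMem] at hload
  simpa using hload

theorem initCounters_zero : initCounters 0 0 = 0 := by
  funext c
  rcases c with _ | _ | _ | _ | _ | _ <;> rfl

open Classical in
theorem exists_runs_decide : ∃ (P : Program (Alphabet Bit) (Control Bit)) (p : Polynomial ℕ),
    ∀ I : GenReachInput, I.arena.IsOnePlayer → (∀ i, (I.target i).ncard = 2) →
      P.Runs (p.eval I.encode.length)
        (conf (true, none) ⟨I.encode, [], [], []⟩ 0)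
        (conf (true, none) ⟨[], [decide I.EveWins], [], []⟩ 0) := by
  obtain ⟨P, p, hP⟩ := realizable_solve
  refine ⟨.seq (load (bitCell .start) (bitCell .reach) (bitCell .color)) (.seq P (answer .failure)),
    (.X * (4 * .X + 7) + 8 * .X + 13) + (p + (.X * (6 * .X + 15) + 17 * .X + 12)),
    fun I hI hF => ?_⟩
  have hlen := add_lt_length_encode I
  have hn : 0 < I.n := I.start.pos
  have hsolve := hP I.encode.length I.n (I.n + I.k + 1) (initCounters I.n (I.n + I.k + 1))
    (inputMem I) (by omega) hlen rfl
    (fun r => by cases r <;> simp [values, initCounters, bound, hn]) fun r _ => ⟨rfl, rfl⟩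
  have hvalues : values (initCounters I.n (I.n + I.k + 1)) = 0 := rfl
  rw [hvalues] at hsolve
  have hanswer : decide I.EveWins = !sweepAll solve (bound I.n (I.n + I.k + 1)) 0 (inputMem I) 0 0
      .failure := by
    rw [Bool.eq_iff_iff, decide_eq_true_iff, Bool.not_eq_true',
      eveWins_iff_sweepAll_solve hI hF (Nat.lt_succ_self _)]
  have hrun := (runs_load_encode I).seq (hsolve.seq (runs_answer hn (Nat.succ_pos _) _ .failure))
  rw [← hanswer, initCounters_zero] at hrun
  refine hrun.mono ?_
  simp only [Polynomial.eval_add, Polynomial.eval_mul, Polynomial.eval_X, Polynomial.eval_ofNat]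
  gcongr <;> omega

open Classical in
theorem solvableInPolyTime {α : Type} [Finite β] {enc : α → List (Option Bool)}
    {Q : α → Prop} (P : Program (Alphabet β) (Control β)) (p : Polynomial ℕ)
    (hP : ∀ x, P.Runs (p.eval (enc x).length)
      (conf (true, none) ⟨enc x, [], [], []⟩ 0)
      (conf (true, none) ⟨[], [decide (Q x)], [], []⟩ 0)) :
    SolvableInPolyTime enc Q := by
  classical
  have := Fintype.ofFinite β
  have := P.fintype
  refine ⟨⟨⟨{
    k₀ := Stack.inp
    k₁ := Stack.out
    Γ := Alphabet β
    Λ := P.Λ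
    main := P.entry
    σ := Control β
    initialState := (true, none)
    Γk₀Fin := inferInstanceAs (Fintype (Option Bool))
    m := P.m }, Equiv.refl _, Equiv.refl _⟩, p,
    fun x => ⟨⟨(hP x).some.steps, ?_⟩, (hP x).some.steps_le_m⟩⟩⟩
  refine Eq.trans (congrArg _ (congrArg some ?_))
    ((hP x).some.evals_in_steps.trans (congrArg some ?_))
  · unfold initList
    congr 1
    funext k
    rcases k with _ | _
    · exact List.map_id _
    all_goals rfl
  · unfold haltList
    congr 1
    funext k
    rcases k with _ | _
    · rfl
    · exact (List.map_id _).symm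
    all_goals rfl

end GridMachine

theorem mainTheorem7_general :
    SolvableInPolyTime
      (fun I : {I : GenReachInput // I.arena.IsOnePlayer ∧ ∀ i, (I.target i).ncard = 2} =>
        I.1.encode)
      (fun I => I.1.EveWins) ∧
    ∀ (V : Type*) (A : Arena V) (_ : A.IsOnePlayer) (k : ℕ) (x y : Fin k → V) (v₀ : V),
      A.EveWins (A.genReach fun i => {x i, y i}) v₀ ↔ (A.formula x y v₀).Satisfiable := by
  refine ⟨?_, fun V A hA k x y v₀ => hA.eveWins_iff_formula_satisfiable x y v₀⟩
  obtain ⟨P, p, hP⟩ := GridMachine.exists_runs_decide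
  exact GridMachine.solvableInPolyTime P p fun I => hP I.1 I.2.1 I.2.2

theorem mainTheorem7 :
    SolvableInPolyTime
      (fun I : {I : GenReachInput // I.arena.IsOnePlayer ∧ ∀ i, (I.target i).ncard = 2} =>
        I.1.encode)
      (fun I => I.1.EveWins) ∧
    ∀ (V : Type*) [Finite V] (A : Arena V) (_ : A.IsOnePlayer) (k : ℕ) (x y : Fin k → V)
      (_ : ∀ i, x i ≠ y i) (v₀ : V),
      A.EveWins (A.genReach fun i => {x i, y i}) v₀ ↔ (A.formula x y v₀).Satisfiable :=
  mainTheorem7_general.imp_right fun h V _ A hA k x y _ v₀ => h V A hA k x y v₀
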